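/- All matrices are finite and binary (entries $0$ and $1$). A matrix has the \emph{circular-ones property for rows} if its columns can be circularly arranged so that the $1$'s of each row occur consecutively in the arrangement, the \emph{circular-ones property for columns} if its transpose has the circular-ones property for rows, and the \emph{circular-ones property for rows and columns} if it has both. A matrix $M$ \emph{contains $M'$ as a configuration} if some submatrix of $M$ equals $M'$ up to permutations of rows and of columns. A matrix $M$ is a \emph{minimal forbidden submatrix for the circular-ones property for rows and columns} if $M$ does not have this property but every submatrix of $M$ different from $M$ has it. For $k\ge 3$ let $M_I(k)$ be the $k\times k$ matrix whose row $i$ has $1$'s exactly in columns $i$ and $i+1$ for $1\le i\le k-1$, and whose row $k$ has $1$'s exactly in columns $1$ and $k$. Let $$M_V=\begin{pmatrix}1&1&0&0&0\\1&1&1&1&0\\0&0&1&1&0\\1&0&0&1&1\end{pmatrix}.$$ Let $M^*$ arise from $M$ by adding a last column of zeros, write $M_I^*(k)=(M_I(k))^*$ and $M_V^*=(M_V)^*$, let $\overline M$ arise from $M$ by exchanging $0$'s and $1$'s everywhere and, for a binary sequence $a=a_1\dots a_k$ and a matrix $M$ with $k$ rows, let $a\odot M$ arise from $M$ by exchanging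 $0$'s and $1$'s in the rows $i$ with $a_i=1$. Let $|a|$ denote the length of $a$. Put $$A=\{0001,\,0011,\,0111,\,00001,\,00011,\,00111,\,01111,\,000111\},$$ $$\mathrm{ForbRowCol}=\bigcup_{k=3}^{\infty}\{M_I^*(k),\overline{M_I^*(k)}\}\ \cup\ \{a\odot M_I^*(|a|) : a\in A\}\ \cup\ \{M_V^*,\overline{M_V^*}\},$$ that is, two infinite families and ten sporadic matrices, and let $\mathrm{ForbRowCol}^{\mathsf T}$ be the set of the transposes of the matrices in $\mathrm{ForbRowCol}$. \textbf{Theorem.} A matrix $M$ has the circular-ones property for rows and columns if and only if $M$ contains no matrix in $\mathrm{ForbRowCol}\cup\mathrm{ForbRowCol}^{\mathsf T}$ as a configuration. Moreover, $\mathrm{ForbRowCol}\cup\mathrm{ForbRowCol}^{\mathsf T}$ is a minimal set having this property (no proper subset of it yields the same characterization), and each matrix in $\mathrm{ForbRowCol}\cup\mathrm{ForbRowCol}^{\mathsf T}$ is a minimal forbidden submatrix for the circular-ones property for rows and columns. -/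

import Mathlib

/-- A binary matrix: `rows × cols`, with entries in `Bool` (`true` is the entry `1`, `false` is the
entry `0`). Rows and columns are labelled from `0`. -/
@[ext]
structure BinMatrix where
  rows : ℕ
  cols : ℕ
  entry : Matrix (Fin rows) (Fin cols) Bool

namespace BinMatrix

/-- The transpose of a binary matrix. -/
def transpose (M : BinMatrix) : BinMatrix :=
  ⟨M.cols, M.rows, M.entry.transpose⟩

/-- The complement of a binary matrix: all entries are exchanged. -/
def compl (M : BinMatrix) : BinMatrix :=
  ⟨M.rows, M.cols, fun i j => !(M.entry i j)⟩

/-- For a binary sequence `a` whose length is the number of rows of `M`, the matrix obtained from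
`M` by complementing the rows `i` with `a i = 1`. -/
def complRows (M : BinMatrix) (a : Fin M.rows → Bool) : BinMatrix :=
  ⟨M.rows, M.cols, fun i j => xor (a i) (M.entry i j)⟩

/-- The matrix `M*`, obtained from `M` by adding one last column consisting of zeros. -/
def addZeroCol (M : BinMatrix) : BinMatrix :=
  ⟨M.rows, M.cols + 1, fun i j => if h : (j : ℕ) < M.cols then M.entry i ⟨j, h⟩ else false⟩

/-- `N` is a submatrix of `M`: it arises by selecting some rows and some columns of `M`, kept in
their order. -/
def IsSubmatrix (N M : BinMatrix) : Prop :=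
  ∃ (ρ : Fin N.rows ↪o Fin M.rows) (σ : Fin N.cols ↪o Fin M.cols),
    ∀ i j, N.entry i j = M.entry (ρ i) (σ j)

/-- `N` and `N'` represent the same configuration: they are equal up to permutations of rows and
of columns. -/
def SameConfiguration (N N' : BinMatrix) : Prop :=
  ∃ (e : Fin N.rows ≃ Fin N'.rows) (f : Fin N.cols ≃ Fin N'.cols),
    ∀ i j, N.entry i j = N'.entry (e i) (f j)

/-- `M` contains `M'` as a configuration: some submatrix of `M` equals `M'` up to permutations of
rows and of columns. -/
def ContainsConfiguration (M M' : BinMatrix) : Prop :=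
  ∃ N : BinMatrix, N.IsSubmatrix M ∧ N.SameConfiguration M'

end BinMatrix

/-- A set of positions on a circle with `n` positions is circularly consecutive if it is
`{s, s + 1, …, s + l - 1}` modulo `n` for some start `s` and some length `l` (possibly `0`). -/
def CircularlyConsecutive {n : ℕ} (S : Set (Fin n)) : Prop :=
  ∃ s l : ℕ, ∀ j : Fin n, j ∈ S ↔ ∃ t < l, (j : ℕ) = (s + t) % n

namespace BinMatrix

/-- The circular-ones property (for rows): the columns can be circularly arranged (column `π p` is
put at position `p`) so that the ones of each row occur consecutively. -/
def CircularOnesRows (M : BinMatrix) : Prop :=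
  ∃ π : Equiv.Perm (Fin M.cols), ∀ i : Fin M.rows,
    CircularlyConsecutive {p : Fin M.cols | M.entry i (π p) = true}

/-- The circular-ones property for columns: rows and columns change roles. -/
def CircularOnesCols (M : BinMatrix) : Prop :=
  M.transpose.CircularOnesRows

/-- The circular-ones property for rows and columns. -/
def CircularOnesRowsCols (M : BinMatrix) : Prop :=
  M.CircularOnesRows ∧ M.CircularOnesCols

/-- `M` is a minimal forbidden submatrix for the circular-ones property for rows and columns. -/
def IsMinimalForbiddenRowsCols (M : BinMatrix) : Prop :=
  ¬ M.CircularOnesRowsCols ∧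
    ∀ N : BinMatrix, N.IsSubmatrix M → N ≠ M → N.CircularOnesRowsCols

/-- The Tucker matrix `M_I(k)`: the `k × k` matrix whose row `i` has its ones exactly in the columns
`i` and `i + 1` modulo `k` (used for `k ≥ 3`). -/
def MI (k : ℕ) : BinMatrix :=
  ⟨k, k, fun i j => decide ((j : ℕ) = i ∨ (j : ℕ) = (i + 1) % k)⟩

/-- The Tucker matrix `M_V`. -/
def MV : BinMatrix :=
  ⟨4, 5, fun i j => decide ((!![1, 1, 0, 0, 0;
                                1, 1, 1, 1, 0;
                                0, 0, 1, 1, 0;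
                                1, 0, 0, 1, 1] : Matrix (Fin 4) (Fin 5) ℕ) i j = 1)⟩

/-- The matrix `M_I(k)*`. -/
def MIast (k : ℕ) : BinMatrix := (MI k).addZeroCol

/-- The matrix `M_V*`. -/
def MVast : BinMatrix := MV.addZeroCol

/-- The binary sequences
`0001, 0011, 0111, 00001, 00011, 00111, 01111, 000111`. -/
def ARowCol : Set (List Bool) :=
  { [false, false, false, true],
    [false, false, true, true],
    [false, true, true, true],
    [false, false, false, false, true],
    [false, false, false, true, true],
    [false, false, true, true, true],
    [false, true, true, true, true],
    [false, false, false, true, true, true] }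

/-- The two infinite families `M_I(k)*` and `co-M_I(k)*`, for `k ≥ 3`, and ten sporadic matrices. -/
def ForbRowCol : Set BinMatrix :=
  {N | ∃ k : ℕ, 3 ≤ k ∧ (N = MIast k ∨ N = (MIast k).compl)} ∪
  {N | ∃ a ∈ ARowCol, N = (MIast a.length).complRows a.get} ∪
  {MVast, MVast.compl}

/-- The matrices of `ForbRowCol` together with their transposes. -/
def ForbRowColSymm : Set BinMatrix :=
  ForbRowCol ∪ transpose '' ForbRowCol

/-- The circular-ones property for rows and columns is characterized by forbidding the matrices
of `F` as configurations. -/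
def CharacterizesCircularOnesRowsCols (F : Set BinMatrix) : Prop :=
  ∀ M : BinMatrix, M.CircularOnesRowsCols ↔ ∀ N ∈ F, ¬ M.ContainsConfiguration N

end BinMatrix

/-!
Whether a row is an arc of a circular order does not change when the row is complemented, so a
row is treated as a bipartition of the set of columns, and an arrangement as a function `f` to `ℕ`
for which every row is an arc (`ArcRow`). Two things have to be shown: a Tucker-type theorem for one
direction, and the finite list that remains when both directions are forbidden at once.

*One direction.* A family of bipartitions without circular order contains, up to complementation
of rows, either a cycle `M_I(k)*` (`CyclePattern`) or three rows that single out three disjoint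
pairs together with a row that splits each pair (`TransversalPattern`); this is
`exists_arcs_of_not_hasPattern`. If a maximal family `C` of rows connected under crossing is not
the whole family, then every row outside `C` is constant outside of one class of elements not
separated by `C`; the rows living inside such a class and the other ones are arranged independently
and glued. A crossing-connected family is built up by adding one row `r` at a time. Its classes are
contiguous in every circular order, and if `r` alternates on no four classes
(`NotAlternating`), then the order can be rearranged inside the classes so that `r` becomes an arc
(`exists_arcs_insert`). That `r` does not alternate is proved by induction along the crossing
sequence (`notAlternating_of_not_hasPattern`): an alternation that becomes visible only through the
last row `p` lies at a class split by both `p` and `r`, and either a shortest chain of rows around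
this class closes up to a cycle (`hasPattern_of_split_atom`), or the order forces a second
class split by both rows, which gives a transversal or a short cycle
(`hasPattern_of_two_split_atoms`).

*Both directions.* A transversal yields `M_V*`, its complement, or the transpose of `M_I(3)*`
or of its complement (`containsForbidden_of_transversalPattern`). A cycle yields `a ⊙ M_I(k)*` for some binary sequence
`a`. If `a` is not constant and `k ≥ 7`, four rows and three columns near a change of `a` form a
transposed `M_I(3)*` up to complementation; for `4 ≤ k ≤ 6` the same happens, except for the
rotations of the eight listed sequences (`containsForbidden_cycleMatrix`). Complementing rows of
`M_I(3)*` itself gives only `M_I(3)*` and its complement, as configurations.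

*Minimality.* For each forbidden matrix explicit arrangements are given after deletion of a row or
a column. The matrices are pairwise different configurations, distinguished by their dimensions,
their numbers of ones and the presence of a column of zeros (`eq_of_sameConfiguration`); hence
none of them can be omitted.
-/

/-! ### Arcs, crossing rows and forbidden patterns -/

/-- The row `R` is an arc of the circular order in which `f` arranges the elements of `X`: one of
its two colour classes is an interval. Elements with equal values of `f` are not separated by `R`,
so `f` need not be injective. -/
def ArcRow {X : Type*} (f : X → ℕ) (R : X → Bool) : Prop :=
  ∃ v, ∀ a b c, R a = v → R c = v → f a ≤ f b → f b ≤ f c → R b = v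

/-- In the circular order given by `f`, the elements `a` and `c` strictly separate `b` from `d`. -/
def Alternate {X : Type*} (f : X → ℕ) (a b c d : X) : Prop :=
  (f a < f b ∧ f b < f c ∧ f c < f d) ∨ (f b < f c ∧ f c < f d ∧ f d < f a) ∨
  (f c < f d ∧ f d < f a ∧ f a < f b) ∨ (f d < f a ∧ f a < f b ∧ f b < f c) ∨
  (f d < f c ∧ f c < f b ∧ f b < f a) ∨ (f c < f b ∧ f b < f a ∧ f a < f d) ∨
  (f b < f a ∧ f a < f d ∧ f d < f c) ∨ (f a < f d ∧ f d < f c ∧ f c < f b)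

/-- Two rows cross if, as bipartitions of `X`, they cut it into four nonempty parts. -/
def Cross {X : Type*} (p q : X → Bool) : Prop := ∀ s t : Bool, ∃ x, p x = s ∧ q x = t

/-- Families of rows that are connected under crossing, built by adding one row at a time. -/
inductive CrossConn {X : Type*} : Set (X → Bool) → Prop
  | single (r : X → Bool) : CrossConn {r}
  | insert (r : X → Bool) {Q : Set (X → Bool)} (q : X → Bool) :
      CrossConn Q → q ∈ Q → Cross r q → CrossConn (insert r Q)

/-- No row of `Q` separates `x` from `y`. -/
def SameAtom {X : Type*} (Q : Set (X → Bool)) (x y : X) : Prop := ∀ q ∈ Q, q x = q y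

/-- The family `F` contains `M_I(k)*` up to complementation of rows: the row `R i` separates exactly
`z i` and `z (i + 1)` (indices modulo `k`) from the element `o` of the additional column. -/
def CyclePattern {X : Type*} (F : Set (X → Bool)) (k : ℕ) : Prop :=
  ∃ (R : ℕ → X → Bool) (z : ℕ → X) (o : X), (∀ i < k, R i ∈ F) ∧
    ∀ i < k, ∀ j < k, (R i (z j) ≠ R i o ↔ j = i ∨ j = (i + 1) % k)

/-- The family `F` contains, up to complementation of rows, three rows that single out three
disjoint pairs and a fourth row that splits each of these pairs. -/
def TransversalPattern {X : Type*} (F : Set (X → Bool)) : Prop :=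
  ∃ q₁ ∈ F, ∃ q₂ ∈ F, ∃ q₃ ∈ F, ∃ t ∈ F, ∃ a a' b b' c c' : X,
    (q₁ a' = q₁ a ∧ q₁ b ≠ q₁ a ∧ q₁ b' ≠ q₁ a ∧ q₁ c ≠ q₁ a ∧ q₁ c' ≠ q₁ a) ∧
    (q₂ b' = q₂ b ∧ q₂ a ≠ q₂ b ∧ q₂ a' ≠ q₂ b ∧ q₂ c ≠ q₂ b ∧ q₂ c' ≠ q₂ b) ∧
    (q₃ c' = q₃ c ∧ q₃ a ≠ q₃ c ∧ q₃ a' ≠ q₃ c ∧ q₃ b ≠ q₃ c ∧ q₃ b' ≠ q₃ c) ∧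
    (t b = t a ∧ t c = t a ∧ t a' ≠ t a ∧ t b' ≠ t a ∧ t c' ≠ t a)

/-- The family contains one of the obstructions to a circular order, up to complementation of
rows. -/
def HasPattern {X : Type*} (F : Set (X → Bool)) : Prop :=
  (∃ k, 3 ≤ k ∧ CyclePattern F k) ∨ TransversalPattern F

theorem Bool.eq_of_ne_of_ne : ∀ {a b c : Bool}, a ≠ c → b ≠ c → a = b := by decide

section Patterns

variable {X : Type*}

theorem CyclePattern.mono {F G : Set (X → Bool)} (h : F ⊆ G) {k : ℕ} (hF : CyclePattern F k) :
    CyclePattern G k := by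
  obtain ⟨R, z, o, hR, hz⟩ := hF
  exact ⟨R, z, o, fun i hi => h (hR i hi), hz⟩

theorem HasPattern.mono {F G : Set (X → Bool)} (h : F ⊆ G) (hF : HasPattern F) :
    HasPattern G := by
  rcases hF with ⟨k, hk, hF⟩ | ⟨q₁, h₁, q₂, h₂, q₃, h₃, t, ht, H⟩
  · exact Or.inl ⟨k, hk, hF.mono h⟩
  · exact Or.inr ⟨q₁, h h₁, q₂, h h₂, q₃, h h₃, t, h ht, H⟩

/-- The three splits of four elements into two pairs form a cycle pattern of length `3`. -/
theorem cyclePattern_three {F : Set (X → Bool)} {p q r : X → Bool} (hp : p ∈ F) (hq : q ∈ F)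
    (hr : r ∈ F) {a b c d : X} (p1 : p a = p b) (p2 : p c = p d) (p3 : p a ≠ p c)
    (q1 : q a = q c) (q2 : q b = q d) (q3 : q a ≠ q b)
    (r1 : r a = r d) (r2 : r b = r c) (r3 : r a ≠ r b) : CyclePattern F 3 := by
  refine ⟨fun i => if i = 0 then p else if i = 1 then r else q,
    fun i => if i = 0 then a else if i = 1 then b else c, d, ?_, ?_⟩
  · intro i hi
    interval_cases i <;> simp [*]
  · intro i hi j hj
    interval_cases i <;> interval_cases j <;> simp <;> grind

theorem hasPattern_of_three {F : Set (X → Bool)} {p q r : X → Bool} (hp : p ∈ F) (hq : q ∈ F)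
    (hr : r ∈ F) {a b c d : X} (p1 : p a = p b) (p2 : p c = p d) (p3 : p a ≠ p c)
    (q1 : q a = q c) (q2 : q b = q d) (q3 : q a ≠ q b)
    (r1 : r a = r d) (r2 : r b = r c) (r3 : r a ≠ r b) : HasPattern F :=
  Or.inl ⟨3, le_rfl, cyclePattern_three hp hq hr p1 p2 p3 q1 q2 q3 r1 r2 r3⟩

theorem ArcRow.eq_of_eq {f : X → ℕ} {R : X → Bool} (h : ArcRow f R) {a b : X} (hab : f a = f b) :
    R a = R b := by
  obtain ⟨v, hv⟩ := h
  have h1 := fun ha => hv a b a ha ha hab.le hab.ge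
  have h2 := fun ha => hv b a b ha ha hab.ge hab.le
  cases v <;> cases ha : R a <;> cases hb : R b <;> simp_all

/-- An arc does not alternate on four elements in linear order. -/
theorem ArcRow.not_lt {f : X → ℕ} {R : X → Bool} (h : ArcRow f R) {a b c d : X}
    (h1 : f a < f b) (h2 : f b < f c) (h3 : f c < f d) (hac : R a = R c) (hbd : R b = R d) :
    R a = R b := by
  obtain ⟨v, hv⟩ := h
  by_cases ha : R a = v
  · rw [ha, hv a b c ha (hac ▸ ha) h1.le h2.le]
  · by_cases hb : R b = v
    · exact absurd (hac.trans (hv b c d hb (hbd ▸ hb) h2.le h3.le)) ha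
    · cases v <;> simp_all

theorem ArcRow.not_alternate {f : X → ℕ} {R : X → Bool} (h : ArcRow f R) {a b c d : X}
    (H : Alternate f a b c d) (hac : R a = R c) (hbd : R b = R d) : R a = R b := by
  rcases H with H | H | H | H | H | H | H | H
  · exact h.not_lt H.1 H.2.1 H.2.2 hac hbd
  · have := h.not_lt H.1 H.2.1 H.2.2 hbd hac.symm; grind
  · have := h.not_lt H.1 H.2.1 H.2.2 hac.symm hbd.symm; grind
  · have := h.not_lt H.1 H.2.1 H.2.2 hbd.symm hac; grind
  · have := h.not_lt H.1 H.2.1 H.2.2 hbd.symm hac.symm; grind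
  · have := h.not_lt H.1 H.2.1 H.2.2 hac.symm hbd; grind
  · have := h.not_lt H.1 H.2.1 H.2.2 hbd hac; grind
  · have := h.not_lt H.1 H.2.1 H.2.2 hac hbd.symm; grind

theorem Alternate.rotate {f : X → ℕ} {a b c d : X} (h : Alternate f a b c d) :
    Alternate f b c d a := by
  unfold Alternate at *
  rcases h with h | h | h | h | h | h | h | h <;> simp [h]

theorem Alternate.reflect {f : X → ℕ} {a b c d : X} (h : Alternate f a b c d) :
    Alternate f b a d c := by
  unfold Alternate at *
  rcases h with h | h | h | h | h | h | h | h <;> simp [h]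

theorem Alternate.ne {f : X → ℕ} {a b c d : X} (h : Alternate f a b c d) :
    f a ≠ f b ∧ f a ≠ f c ∧ f a ≠ f d ∧ f b ≠ f c ∧ f b ≠ f d ∧ f c ≠ f d := by
  rcases h with h | h | h | h | h | h | h | h <;> omega

/-- A fifth element lies on one of the two sides of the pair `a`, `c`. -/
theorem Alternate.side {f : X → ℕ} {a b c d : X} (h : Alternate f a b c d) {e : X}
    (ha : f e ≠ f a) (hc : f e ≠ f c) : Alternate f a e c d ∨ Alternate f a b c e := by
  unfold Alternate at *
  rcases lt_or_gt_of_ne ha with h1 | h1 <;> rcases lt_or_gt_of_ne hc with h2 | h2 <;>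
  rcases h with h | h | h | h | h | h | h | h <;> grind

theorem Cross.symm {p q : X → Bool} (h : Cross p q) : Cross q p := fun s t => by
  obtain ⟨x, h1, h2⟩ := h t s
  exact ⟨x, h2, h1⟩

/-- A property of rows that is passed on along crossings holds throughout the family. -/
theorem CrossConn.propagate {Q : Set (X → Bool)} (h : CrossConn Q) (T : (X → Bool) → Prop)
    (hT : ∀ p ∈ Q, ∀ q ∈ Q, Cross p q → T p → T q) {p q : X → Bool} (hp : p ∈ Q) (hq : q ∈ Q)
    (h0 : T p) : T q := by
  have key : (∀ q ∈ Q, T q) ∨ (∀ q ∈ Q, ¬ T q) := by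
    clear h0 hp hq
    induction h with
    | single r =>
      by_cases hr : T r
      · exact Or.inl (by simpa using hr)
      · exact Or.inr (by simpa using hr)
    | insert r q _ hqQ hc ih =>
      rcases ih (fun p hp q hq => hT p (Or.inr hp) q (Or.inr hq)) with ih | ih
      · left
        rintro s (rfl | hs)
        · exact hT q (Or.inr hqQ) s (Or.inl rfl) hc.symm (ih q hqQ)
        · exact ih s hs
      · right
        rintro s (rfl | hs)
        · exact fun h => ih q hqQ (hT s (Or.inl rfl) q (Or.inr hqQ) hc h)
        · exact ih s hs
  rcases key with key | key
  · exact key q hq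
  · exact absurd h0 (key p hp)

theorem CrossConn.singleton_or_cross {Q : Set (X → Bool)} (h : CrossConn Q) :
    (∃ q, Q = {q}) ∨ ∃ p ∈ Q, ∃ q ∈ Q, Cross p q := by
  cases h with
  | single r => exact Or.inl ⟨r, rfl⟩
  | insert r q _ hq hc => exact Or.inr ⟨r, Or.inl rfl, q, Or.inr hq, hc⟩

theorem SameAtom.symm {Q : Set (X → Bool)} {x y : X} (h : SameAtom Q x y) : SameAtom Q y x :=
  fun q hq => (h q hq).symm

theorem SameAtom.trans {Q : Set (X → Bool)} {x y w : X} (h : SameAtom Q x y)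
    (h' : SameAtom Q y w) : SameAtom Q x w := fun q hq => (h q hq).trans (h' q hq)

/-- Atoms of a crossing-connected family of arcs are contiguous in the circular order: the rows of
the family that meet one of the two sides of a pair of equivalent elements cannot cross those that
meet the other side. -/
theorem SameAtom.contiguous {Q : Set (X → Bool)} (hQ : CrossConn Q) {f : X → ℕ}
    (hf : ∀ q ∈ Q, ArcRow f q) {a b c d : X} (h : Alternate f a b c d) (hac : SameAtom Q a c) :
    SameAtom Q a b ∨ SameAtom Q a d := by
  by_contra! hcon
  obtain ⟨h1, h2⟩ := hcon
  simp only [SameAtom, not_forall] at h1 h2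
  obtain ⟨q₁, hq₁, h1⟩ := h1
  obtain ⟨q₂, hq₂, h2⟩ := h2
  have step : ∀ q ∈ Q, ∀ e, q e ≠ q a → Alternate f a e c d → ∀ e', q e' ≠ q a →
      Alternate f a e' c d := by
    intro q hq e he halt e' he'
    have hne : ∀ g, f g = f e' → q g = q e' := fun g hg => (hf q hq).eq_of_eq hg
    rcases halt.side (e := e') (fun H => he' (hne a H.symm).symm)
      (fun H => he' ((hne c H.symm).symm.trans (hac q hq).symm)) with H | H
    · exact H
    · exact absurd ((hf q hq).not_alternate H (hac q hq) (Bool.eq_of_ne_of_ne he he')).symm he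
  have := hQ.propagate (fun q => ∀ e, q e ≠ q a → Alternate f a e c d) ?_ hq₁ hq₂
    (step q₁ hq₁ b (Ne.symm h1) h) d (Ne.symm h2)
  · exact this.ne.2.2.2.2.1 rfl
  · intro p hp q hq hc hT
    obtain ⟨e, he1, he2⟩ := hc (!p a) (!q a)
    exact step q hq e (by simp [he2]) (hT e (by simp [he1]))

end Patterns

/-! ### Split atoms and induced chains -/

section Key

variable {X : Type*}

/-- The circular order given by `f` restricts to the cyclic sequence `a, b, c, d, e`. -/
def Cyclic5 (f : X → ℕ) (a b c d e : X) : Prop :=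
  Alternate f a b c d ∧ Alternate f b c d e ∧ Alternate f a c d e ∧ Alternate f a b d e ∧
    Alternate f a b c e

theorem Alternate.cyclic5 {f : X → ℕ} {a b c d e : X} (h : Alternate f a b c d)
    (h' : Alternate f a b c e) (hde : f d ≠ f e) : Cyclic5 f a b c d e ∨ Cyclic5 f a b c e d := by
  unfold Cyclic5 Alternate at *
  rcases lt_or_gt_of_ne hde with h1 | h1 <;>
  rcases h with h | h | h | h | h | h | h | h <;> grind

theorem Cyclic5.rotate {f : X → ℕ} {a b c d e : X} (h : Cyclic5 f a b c d e) :
    Cyclic5 f b c d e a :=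
  ⟨h.2.1, h.2.2.1.rotate, h.2.2.2.1.rotate, h.2.2.2.2.rotate, h.1.rotate⟩

theorem Alternate.swap_false {f : X → ℕ} {a b c d : X} (h : Alternate f a b c d)
    (h' : Alternate f a b d c) : False := by
  unfold Alternate at *
  rcases h with h | h | h | h | h | h | h | h <;> omega

/-- The four places where a fifth element can be inserted into a cyclic sequence. -/
theorem Alternate.insert {f : X → ℕ} {a b c d e : X} (h : Alternate f a b c d)
    (ha : f e ≠ f a) (hb : f e ≠ f b) (hc : f e ≠ f c) (hd : f e ≠ f d) :
    Cyclic5 f a e b c d ∨ Cyclic5 f a b e c d ∨ Cyclic5 f a b c e d ∨ Cyclic5 f a b c d e := by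
  rcases h.side ha hc with h' | h'
  · rcases h'.rotate.rotate.cyclic5 h.rotate.rotate hb with H | H
    · exact Or.inl H.rotate.rotate
    · exact Or.inr (Or.inl H.rotate.rotate)
  · rcases h.cyclic5 h' hd.symm with H | H
    · exact Or.inr (Or.inr (Or.inr H))
    · exact Or.inr (Or.inr (Or.inl H))

/-- Two atoms are both split by `p` and by `r`, and `p` and `r` are constant outside of them. Either
some row of `Q` separating the two atoms is crossed by a row that does not, or all rows of `Q`
separate them; both cases give a pattern. -/
theorem hasPattern_of_two_split_atoms {Q : Set (X → Bool)} (hQ : CrossConn Q)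
    (hQ2 : ∃ q ∈ Q, ∃ q' ∈ Q, Cross q q') {p r : X → Bool} {x y u v : X}
    (hxy : SameAtom Q x y) (huv : SameAtom Q u v) (hxu : ¬ SameAtom Q x u)
    (pxy : p x ≠ p y) (rxy : r x ≠ r y) (pu : p u = p y) (pv : p v = p x) (ru : r u = r y)
    (rv : r v = r x)
    (hout : ∀ e, ¬ SameAtom Q x e → ¬ SameAtom Q u e → p e = p x ∧ r e = r y) :
    HasPattern (insert p (insert r Q)) := by
  have hsub : Q ⊆ insert p (insert r Q) := fun q hq => Or.inr (Or.inr hq)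
  by_cases hT : ∃ q ∈ Q, ∃ q' ∈ Q, Cross q q' ∧ q x ≠ q u ∧ q' x = q' u
  · obtain ⟨q, hq, q', hq', hc, h1, h2⟩ := hT
    -- `p`, `r` and `q'` single out the pairs `y, u` and `x, v` and `e, g`, and `q` splits them
    obtain ⟨e, he1, he2⟩ := hc (q x) (!q' x)
    obtain ⟨g, hg1, hg2⟩ := hc (q u) (!q' x)
    have e1 := hout e (fun h => by have := h q' hq'; grind)
      (fun h => by have := h q' hq'; grind)
    have g1 := hout g (fun h => by have := h q' hq'; grind)
      (fun h => by have := h q' hq'; grind)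
    have a1 := hxy q hq
    have a2 := hxy q' hq'
    have a3 := huv q hq
    have a4 := huv q' hq'
    refine Or.inr ⟨p, Or.inl rfl, r, Or.inr (Or.inl rfl), q', hsub hq', q, hsub hq,
      y, u, x, v, e, g, ?_⟩
    grind
  · push Not at hT
    obtain ⟨s, hs, hsx⟩ : ∃ s ∈ Q, s x ≠ s u := by
      simpa [SameAtom] using hxu
    have hall : ∀ q ∈ Q, q x ≠ q u := fun q hq =>
      hQ.propagate (fun q => q x ≠ q u) (fun p hp q hq hc h => hT p hp q hq hc h) hs hq hsx
    -- now all rows of `Q` separate the two atoms, and any two crossing ones give a short cycle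
    obtain ⟨q, hq, q', hq', hc⟩ := hQ2
    have b1 := hall q hq
    have b2 := hall q' hq'
    obtain ⟨e, he1, he2⟩ := hc (q x) (q' u)
    obtain ⟨g, hg1, hg2⟩ := hc (q u) (q' x)
    have e1 := hout e (fun h => by have := h q' hq'; grind)
      (fun h => by have := h q hq; grind)
    have g1 := hout g (fun h => by have := h q hq; grind)
      (fun h => by have := h q' hq'; grind)
    have a1 := hxy q hq
    have a2 := hxy q' hq'
    apply hasPattern_of_three (p := p) (q := q) (r := q') (a := y) (b := u) (c := e) (d := g)
      (Or.inl rfl) (hsub hq) (hsub hq') <;> grind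

/-- A chain of rows of `Q` from `z 0` to `z t`: the row `q i` satisfies `N` at `z i` and
`z (i + 1)`. -/
def RowChain {X : Type*} (Q : Set (X → Bool)) (N : (X → Bool) → X → Prop) (t : ℕ) (z : ℕ → X)
    (q : ℕ → X → Bool) : Prop :=
  ∀ i < t, q i ∈ Q ∧ N (q i) (z i) ∧ N (q i) (z (i + 1))

/-- A shortest chain between two sets of elements has no shortcuts. -/
theorem exists_induced_chain {Q : Set (X → Bool)} {N : (X → Bool) → X → Prop} {A B : X → Prop}
    (h : ∃ t z q, RowChain Q N t z q ∧ A (z 0) ∧ B (z t)) :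
    ∃ t z q, RowChain Q N t z q ∧ A (z 0) ∧ B (z t) ∧
      (∀ i ≤ t, ∀ j < t, N (q j) (z i) → i = j ∨ i = j + 1) ∧
      (∀ i ≤ t, A (z i) → i = 0) ∧ (∀ i ≤ t, B (z i) → i = t) := by
  classical
  obtain ⟨z, q, hc, hA, hB⟩ := Nat.find_spec h
  have hmin : ∀ m z' q', m < Nat.find h → RowChain Q N m z' q' → A (z' 0) → B (z' m) → False :=
    fun m z' q' hm h1 h2 h3 => Nat.find_min h hm ⟨z', q', h1, h2, h3⟩
  generalize Nat.find h = t at *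
  refine ⟨t, z, q, hc, hA, hB, ?_, ?_, ?_⟩
  · intro i hi j hj hN
    by_contra! hne
    rcases lt_or_ge i j with hij | hij
    · refine hmin (t - (j - i)) (fun n => if n ≤ i then z n else z (n + (j - i)))
        (fun n => if n < i then q n else q (n + (j - i))) (by omega) ?_ (by simpa using hA) ?_
      · intro n hn
        rcases lt_trichotomy n i with h1 | h1 | h1
        · simpa [h1, h1.le, Nat.succ_le_of_lt h1] using hc n (by omega)
        · subst h1
          have := hc j hj
          have e1 : n + (j - n) = j := by omega
          have e2 : n + 1 + (j - n) = j + 1 := by omega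
          simp only [lt_irrefl, if_false, le_refl, if_true, e1, e2,
            show ¬ n + 1 ≤ n by omega]
          exact ⟨this.1, hN, this.2.2⟩
        · have := hc (n + (j - i)) (by omega)
          simpa [show ¬ n < i by omega, show ¬ n ≤ i by omega, show ¬ n + 1 ≤ i by omega,
            show n + 1 + (j - i) = n + (j - i) + 1 by omega] using this
      · have e : t - (j - i) + (j - i) = t := by omega
        simpa [show ¬ t - (j - i) ≤ i by omega, e] using hB
    · refine hmin (t - (i - j - 1)) (fun n => if n ≤ j then z n else z (n + (i - j - 1)))
        (fun n => if n ≤ j then q n else q (n + (i - j - 1))) (by omega) ?_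
        (by simpa using hA) ?_
      · intro n hn
        rcases lt_trichotomy n j with h1 | h1 | h1
        · simpa [h1.le, Nat.succ_le_of_lt h1] using hc n (by omega)
        · subst h1
          have := hc n hj
          have e2 : n + 1 + (i - n - 1) = i := by omega
          simp only [le_refl, if_true, e2, show ¬ n + 1 ≤ n by omega, if_false]
          exact ⟨this.1, this.2.1, hN⟩
        · have := hc (n + (i - j - 1)) (by omega)
          simpa [show ¬ n ≤ j by omega, show ¬ n + 1 ≤ j by omega,
            show n + 1 + (i - j - 1) = n + (i - j - 1) + 1 by omega] using this
      · have e : t - (i - j - 1) + (i - j - 1) = t := by omega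
        simpa [show ¬ t - (i - j - 1) ≤ j by omega, e] using hB
  · intro i hi hAi
    by_contra hne
    refine hmin (t - i) (fun n => z (n + i)) (fun n => q (n + i)) (by omega) ?_
      (by simpa using hAi) ?_
    · intro n hn
      simpa [show n + 1 + i = n + i + 1 by omega] using hc (n + i) (by omega)
    · simpa [show t - i + i = t by omega] using hB
  · intro i hi hBi
    by_contra hne
    exact hmin i z q (by omega) (fun n hn => hc n (by omega)) hA hBi

/-- Any two elements outside an atom of a crossing-connected family are joined by a chain of rows
of the family, each taken on the side that avoids the atom. -/
theorem CrossConn.exists_chain {Q : Set (X → Bool)} (hQ : CrossConn Q) {x u w : X}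
    (hu : ¬ SameAtom Q x u) (hw : ¬ SameAtom Q x w) :
    ∃ t z q, RowChain Q (fun q e => q e ≠ q x) t z q ∧ z 0 = u ∧ z t = w := by
  simp only [SameAtom, not_forall] at hu hw
  obtain ⟨q₁, hq₁, h1⟩ := hu
  obtain ⟨q₂, hq₂, h2⟩ := hw
  refine hQ.propagate (fun q => ∀ e, q e ≠ q x →
    ∃ t z q, RowChain Q (fun q e => q e ≠ q x) t z q ∧ z 0 = u ∧ z t = e) ?_ hq₁ hq₂ ?_ w
    (Ne.symm h2)
  · intro p hp q hq hc hT e he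
    obtain ⟨g, hg1, hg2⟩ := hc (!p x) (!q x)
    obtain ⟨t, z, s, hs, h0, ht⟩ := hT g (by simp [hg1])
    refine ⟨t + 1, fun n => if n ≤ t then z n else e, fun n => if n < t then s n else q, ?_,
      by simpa using h0, by simp⟩
    intro n hn
    rcases Nat.lt_succ_iff_lt_or_eq.mp hn with h3 | rfl
    · simpa [h3, h3.le, Nat.succ_le_of_lt h3] using hs n h3
    · simp [hq, ht, hg2, he]
  · intro e he
    refine ⟨1, fun n => if n = 0 then u else e, fun _ => q₁, ?_, by simp, by simp⟩
    intro n hn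
    obtain rfl : n = 0 := by omega
    simpa [hq₁, he] using Ne.symm h1

/-- An induced chain whose second element is on the `x` side of `p` closes up to a cycle pattern:
through `p` alone at its first element on the other side, or through `r`, `y` and `p`. -/
theorem hasPattern_of_induced_chain {Q : Set (X → Bool)} {p r : X → Bool} {x y : X}
    (hxy : SameAtom Q x y) (pxy : p x ≠ p y) (rxy : r x ≠ r y) {t : ℕ} {z : ℕ → X}
    {q : ℕ → X → Bool} (hc : RowChain Q (fun q e => q e ≠ q x) t z q)
    (hz0 : p (z 0) = p y ∧ r (z 0) = r x) (hzt : p (z t) = p x ∧ r (z t) = r y)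
    (hind : ∀ i ≤ t, ∀ j < t, q j (z i) ≠ q j x → i = j ∨ i = j + 1)
    (hA : ∀ i ≤ t, p (z i) = p y ∧ r (z i) = r x → i = 0)
    (hB : ∀ i ≤ t, p (z i) = p x ∧ r (z i) = r y → i = t)
    (h1 : p (z 1) = p x) : HasPattern (insert p (insert r Q)) := by
  classical
  have hsub : ∀ q ∈ Q, q ∈ insert p (insert r Q) := fun q hq => Or.inr (Or.inr hq)
  have hqiff : ∀ i < t, ∀ j ≤ t, (q i (z j) ≠ q i x ↔ j = i ∨ j = i + 1) := by
    intro i hi j hj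
    refine ⟨hind j hj i hi, ?_⟩
    rintro (rfl | rfl)
    · exact (hc _ hi).2.1
    · exact (hc _ hi).2.2
  have ht : 1 ≤ t := by
    rcases Nat.eq_zero_or_pos t with rfl | h
    · exact absurd (hzt.1.symm.trans hz0.1) pxy
    · exact h
  by_cases hex : ∃ j, 1 ≤ j ∧ j ≤ t ∧ p (z j) ≠ p x
  · obtain ⟨hj1, hjt, hj⟩ := Nat.find_spec hex
    have hmin := fun m (hm : m < Nat.find hex) => Nat.find_min hex hm
    generalize Nat.find hex = j at *
    have hj2 : 2 ≤ j := by
      rcases Nat.lt_or_ge j 2 with h | h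
      · obtain rfl : j = 1 := by omega
        exact absurd h1 hj
      · exact h
    refine Or.inl ⟨j + 1, by omega, fun i => if i < j then q i else p, z, x, ?_, ?_⟩
    · intro i hi
      by_cases h : i < j
      · simpa [h] using hsub _ (hc i (by omega)).1
      · simp [h]
    · intro i hi m hm
      rcases Nat.lt_succ_iff_lt_or_eq.mp hi with h | rfl
      · rw [Nat.mod_eq_of_lt (by omega)]
        simpa [h] using hqiff i (by omega) m (by omega)
      · simp only [lt_irrefl, if_false, Nat.mod_self]
        constructor
        · intro h
          by_contra! hne
          exact hmin m (by omega) ⟨by omega, by omega, h⟩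
        · rintro (rfl | rfl)
          · exact hj
          · rw [hz0.1]; exact pxy.symm
  · push Not at hex
    have hr : ∀ m ≤ t, (r (z m) ≠ r x ↔ m = t) := by
      intro m hm
      constructor
      · intro h
        rcases Nat.eq_zero_or_pos m with rfl | hm0
        · exact absurd hz0.2 h
        · exact hB m hm ⟨hex m hm0 hm, Bool.eq_of_ne_of_ne h rxy.symm⟩
      · rintro rfl
        rw [hzt.2]; exact rxy.symm
    have hp : ∀ m ≤ t, (p (z m) ≠ p x ↔ m = 0) := by
      intro m hm
      constructor
      · intro h
        by_contra hne
        exact h (hex m (by omega) hm)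
      · rintro rfl
        rw [hz0.1]; exact pxy.symm
    refine Or.inl ⟨t + 2, by omega, fun i => if i < t then q i else if i = t then r else p,
      fun i => if i ≤ t then z i else y, x, ?_, ?_⟩
    · intro i hi
      by_cases h : i < t
      · simpa [h] using hsub _ (hc i (by omega)).1
      · by_cases h' : i = t <;> simp [h, h']
    · intro i hi m hm
      rcases lt_trichotomy i t with h | rfl | h
      · rw [Nat.mod_eq_of_lt (by omega)]
        by_cases hm' : m ≤ t
        · simpa [h, hm'] using hqiff i h m hm'
        · have := hxy _ (hc i h).1
          simp only [h, if_true, hm', if_false, this, ne_eq, not_true_eq_false, false_iff]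
          omega
      · rw [Nat.mod_eq_of_lt (by omega)]
        by_cases hm' : m ≤ i
        · simp only [lt_irrefl, if_false, if_true, hm', hr m hm']
          omega
        · simp only [lt_irrefl, if_false, if_true, hm']
          exact iff_of_true rxy.symm (by omega)
      · obtain rfl : i = t + 1 := by omega
        rw [Nat.mod_self]
        by_cases hm' : m ≤ t
        · simp only [show ¬ t + 1 < t by omega, show t + 1 ≠ t by omega, if_false, hm', if_true,
            hp m hm']
          omega
        · simp only [show ¬ t + 1 < t by omega, show t + 1 ≠ t by omega, if_false, hm']
          exact iff_of_true pxy.symm (by omega)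

/-- An atom split by `p` and `r` in one way, while outside of it `p` and `r` are split in the other
way: a shortest chain of rows joining the two outer parts closes up to a cycle pattern. -/
theorem hasPattern_of_split_atom {Q : Set (X → Bool)} (hQ : CrossConn Q) {p r : X → Bool}
    {x y u w : X} (hxy : SameAtom Q x y) (pxy : p x ≠ p y) (rxy : r x ≠ r y)
    (hu : p u = p y ∧ r u = r x) (hw : p w = p x ∧ r w = r y)
    (hxu : ¬ SameAtom Q x u) (hxw : ¬ SameAtom Q x w) :
    HasPattern (insert p (insert r Q)) := by
  obtain ⟨t, z, q, hc, h0, ht⟩ := hQ.exists_chain hxu hxw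
  obtain ⟨t, z, q, hc, h0, ht, hind, hA, hB⟩ := exists_induced_chain
    (A := fun e => p e = p y ∧ r e = r x) (B := fun e => p e = p x ∧ r e = r y)
    ⟨t, z, q, hc, h0 ▸ hu, ht ▸ hw⟩
  by_cases h1 : p (z 1) = p x
  · exact hasPattern_of_induced_chain hxy pxy rxy hc h0 ht hind hA hB h1
  -- otherwise the roles of `p`, `x` and of `r`, `y` are exchanged
  have h2 : r (z 1) = r y := by
    by_contra h3
    have ht : 1 ≤ t := by
      rcases Nat.eq_zero_or_pos t with rfl | h
      · exact absurd (ht.1.symm.trans h0.1) pxy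
      · exact h
    have := hA 1 ht ⟨Bool.eq_of_ne_of_ne h1 pxy.symm, Bool.eq_of_ne_of_ne h3 rxy⟩
    omega
  have hq : ∀ i < t, q i y = q i x := fun i hi => (hxy _ (hc i hi).1).symm
  rw [Set.insert_comm]
  refine hasPattern_of_induced_chain hxy.symm rxy.symm pxy.symm (t := t) (z := z) (q := q) ?_
    h0.symm ht.symm ?_ (fun i hi h => hA i hi h.symm) (fun i hi h => hB i hi h.symm) h2
  · intro i hi
    have := hc i hi
    simpa [hq i hi] using this
  · intro i hi j hj h
    rw [hq j hj] at h
    exact hind i hi j hj h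

end Key

/-! ### A further row does not alternate -/

section Key

variable {X : Type*}

theorem ArcRow.ne_of_not_sameAtom {Q : Set (X → Bool)} {f : X → ℕ} (hf : ∀ q ∈ Q, ArcRow f q)
    {a b : X} (h : ¬ SameAtom Q a b) : f a ≠ f b :=
  fun hab => h fun q hq => (hf q hq).eq_of_eq hab

/-- The row `r` does not alternate on four pairwise inequivalent elements of the circular order. -/
def NotAlternating (Q : Set (X → Bool)) (f : X → ℕ) (r : X → Bool) : Prop :=
  ∀ a b c d, Alternate f a b c d → ¬ SameAtom Q a b → ¬ SameAtom Q a c → ¬ SameAtom Q a d →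
    ¬ SameAtom Q b c → ¬ SameAtom Q b d → ¬ SameAtom Q c d → r a = r c → r b = r d → r a = r b

/-- The case of a conflict between `p` and `r` inside an atom, where both of the elements `c` and
`d` outside of it are on the same side of `p` as `a`. Unless there is a split atom as in
`hasPattern_of_split_atom`, the order forces `p` and `r` to be constant outside of the atoms of `a`
and `c`. -/
theorem hasPattern_of_conflict_same_side {Q : Set (X → Bool)} (hQ : CrossConn Q) {f : X → ℕ}
    (hf : ∀ q ∈ Q, ArcRow f q) {p r q₀ : X → Bool} (hp : ArcRow f p) (hq₀ : q₀ ∈ Q)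
    (hcross : Cross p q₀) (hr : NotAlternating Q f r) {a b c d : X} (h : Alternate f a b c d)
    (hab : SameAtom Q a b) (hac : ¬ SameAtom Q a c) (had : ¬ SameAtom Q a d)
    (hcd : ¬ SameAtom Q c d)
    (pab : p a ≠ p b) (pc : p c = p a) (pd : p d = p a) (rc : r c = r a) (rd : r d = r b)
    (rab : r a ≠ r b) : HasPattern (insert p (insert r Q)) := by
  by_contra hcon
  have hbc : ¬ SameAtom Q b c := fun h => hac (hab.trans h)
  have hbd : ¬ SameAtom Q b d := fun h => had (hab.trans h)
  have fne : ∀ {x y}, ¬ SameAtom Q x y → f x ≠ f y := ArcRow.ne_of_not_sameAtom hf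
  -- an element outside the atom of `a` on the other side of `p`
  obtain ⟨u, hu1, hu2⟩ := hcross (p b) (!q₀ a)
  have hau : ¬ SameAtom Q a u := fun h => by have := h q₀ hq₀; simp [hu2] at this
  have hbu : ¬ SameAtom Q b u := fun h => hau (hab.trans h)
  have hsplit : ∀ e, ¬ SameAtom Q a e → p e = p b → r e = r b := by
    intro e he pe
    by_contra hre
    exact hcon (hasPattern_of_split_atom hQ hab pab rab
      ⟨pe, Bool.eq_of_ne_of_ne hre rab⟩ ⟨pd, rd⟩ he had)
  -- every element outside the atom of `a` and on the other side of `p` is equivalent to `c`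
  have hB : ∀ e, ¬ SameAtom Q a e → p e = p b → Cyclic5 f a b e c d ∧ SameAtom Q c e := by
    intro e hae pe
    have hbe : ¬ SameAtom Q b e := fun h => hae (hab.trans h)
    have hfc : f e ≠ f c := fun h => pab (pc.symm.trans ((hp.eq_of_eq h).symm.trans pe))
    have hfd : f e ≠ f d := fun h => pab (pd.symm.trans ((hp.eq_of_eq h).symm.trans pe))
    have pos : Cyclic5 f a b e c d := by
      rcases h.insert (fne hae).symm (fne hbe).symm hfc hfd with H | H | H | H
      · rcases hab.contiguous hQ hf H.1 with h' | h'
        · exact absurd h' hae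
        · exact absurd h' hac
      · exact H
      · exact absurd (hp.not_alternate H.1 pc.symm pe.symm) pab
      · exact absurd (hp.not_alternate H.2.2.2.1 pd.symm pe.symm) pab
    refine ⟨pos, ?_⟩
    by_contra hce
    have hde : ¬ SameAtom Q e d := by
      intro hed
      rcases hed.contiguous hQ hf (pos.2.2.1.rotate) with h' | h'
      · exact hce h'.symm
      · exact hae h'.symm
    have := hr a e c d pos.2.2.1 hae hac had (fun h => hce h.symm) hde hcd rc.symm
      ((hsplit e hae pe).trans rd.symm)
    exact rab (this.trans (hsplit e hae pe))
  obtain ⟨hucd, hcu⟩ := hB u hau hu1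
  have ru := hsplit u hau hu1
  -- the other elements lie between `c` and `a`
  have pos : ∀ e, ¬ SameAtom Q a e → ¬ SameAtom Q c e →
      p e = p a ∧ Alternate f a b c e ∧ Alternate f a u c e := by
    intro e hae hce
    have pe : p e = p a := by
      by_contra hpe
      exact hce (hB e hae (Bool.eq_of_ne_of_ne hpe pab.symm)).2
    have hbe : ¬ SameAtom Q b e := fun h => hae (hab.trans h)
    have hue : ¬ SameAtom Q u e := fun h => hce (hcu.trans h)
    refine ⟨pe, ?_⟩
    rcases hucd.1.insert (fne hae).symm (fne hbe).symm (fne hue).symm (fne hce).symm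
      with H | H | H | H
    · rcases hab.contiguous hQ hf H.1 with h' | h'
      · exact absurd h' hae
      · exact absurd h' hau
    · exact absurd (hp.not_alternate H.1 pe.symm hu1.symm) pab
    · rcases hcu.symm.contiguous hQ hf H.2.2.1.rotate with h' | h'
      · exact absurd h' hue
      · exact absurd h'.symm hau
    · exact ⟨H.2.2.2.1, H.2.2.1⟩
  have main : ∀ v d', ¬ SameAtom Q a v → ¬ SameAtom Q c v → ¬ SameAtom Q a d' →
      ¬ SameAtom Q c d' → ¬ SameAtom Q v d' → r v = r a → r d' = r b → False := by
    intro v d' hav hcv had' hcd' hvd rv rd'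
    obtain ⟨-, v1, v2⟩ := pos v hav hcv
    obtain ⟨-, d1, d2⟩ := pos d' had' hcd'
    have hud : ¬ SameAtom Q u d' := fun h => hcd' (hcu.trans h)
    have huv : ¬ SameAtom Q u v := fun h => hcv (hcu.trans h)
    have hbv : ¬ SameAtom Q b v := fun h => hav (hab.trans h)
    have hbd' : ¬ SameAtom Q b d' := fun h => had' (hab.trans h)
    rcases v1.cyclic5 d1 (fne hvd) with H | H
    · rcases v2.cyclic5 d2 (fne hvd) with H' | H'
      · exact rab ((hr a u v d' H'.2.2.2.1 hau hav had' huv hud hvd rv.symm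
          (ru.trans rd'.symm)).trans ru)
      · exact H.2.2.1.swap_false H'.2.2.1
    · exact rab ((hr b c d' v H.2.1 hbc hbd' hbv hcd' hcv (fun h => hvd h.symm) rd'.symm
          (rc.trans rv.symm)).trans rc).symm
  -- a fourth atom
  have hQ2 : ∃ q ∈ Q, ∃ q' ∈ Q, Cross q q' := by
    rcases hQ.singleton_or_cross with ⟨q, rfl⟩ | h
    · simp only [SameAtom, Set.mem_singleton_iff, forall_eq] at hac had hcd
      exact absurd (Bool.eq_of_ne_of_ne (Ne.symm hac) (Ne.symm had)) hcd
    · exact h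
  have hfour : ∀ v, ∃ g, ¬ SameAtom Q a g ∧ ¬ SameAtom Q c g ∧ ¬ SameAtom Q v g := by
    intro v
    obtain ⟨q, hq, q', hq', hc⟩ := hQ2
    by_contra! hno
    obtain ⟨e1, h1, h1'⟩ := hc true true
    obtain ⟨e2, h2, h2'⟩ := hc true false
    obtain ⟨e3, h3, h3'⟩ := hc false true
    obtain ⟨e4, h4, h4'⟩ := hc false false
    have key : ∀ e, (q e = q a ∧ q' e = q' a) ∨ (q e = q c ∧ q' e = q' c) ∨
        (q e = q v ∧ q' e = q' v) := by
      intro e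
      by_cases k1 : SameAtom Q a e
      · exact Or.inl ⟨(k1 q hq).symm, (k1 q' hq').symm⟩
      · by_cases k2 : SameAtom Q c e
        · exact Or.inr (Or.inl ⟨(k2 q hq).symm, (k2 q' hq').symm⟩)
        · have := hno e k1 k2
          exact Or.inr (Or.inr ⟨(this q hq).symm, (this q' hq').symm⟩)
    have k1 := key e1
    have k2 := key e2
    have k3 := key e3
    have k4 := key e4
    rw [h1, h1'] at k1
    rw [h2, h2'] at k2
    rw [h3, h3'] at k3
    rw [h4, h4'] at k4
    grind
  have hR : ∀ e, ¬ SameAtom Q a e → ¬ SameAtom Q c e → r e = r b := by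
    intro v hav hcv
    by_contra hrv
    have rv : r v = r a := Bool.eq_of_ne_of_ne hrv rab
    by_cases hvd : SameAtom Q v d
    · obtain ⟨g, hag, hcg, hvg⟩ := hfour v
      by_cases hrg : r g = r b
      · exact main v g hav hcv hag hcg hvg rv hrg
      · exact main g d hag hcg had hcd (fun h => hvg (hvd.trans h.symm))
          (Bool.eq_of_ne_of_ne hrg rab) rd
    · exact main v d hav hcv had hcd hvd rv rd
  refine hcon (hasPattern_of_two_split_atoms hQ hQ2 hab hcu.symm hau pab rab hu1 pc ru rc ?_)
  intro e hae hue
  have hce : ¬ SameAtom Q c e := fun h => hue (hcu.symm.trans h)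
  exact ⟨(pos e hae hce).1, hR e hae hce⟩

end Key

section Key

variable {X : Type*}

theorem SameAtom.ne_of_insert {Q : Set (X → Bool)} {p : X → Bool} {x y : X}
    (h : SameAtom Q x y) (h' : ¬ SameAtom (insert p Q) x y) : p x ≠ p y := fun hxy =>
  h' (by rintro q (rfl | hq); exacts [hxy, h q hq])

theorem SameAtom.not_sameAtom_insert {Q : Set (X → Bool)} {p : X → Bool} {x y w : X}
    (h : SameAtom Q x y) (h' : ¬ SameAtom (insert p Q) x y) (hxw : ¬ SameAtom (insert p Q) x w)
    (hyw : ¬ SameAtom (insert p Q) y w) : ¬ SameAtom Q x w := fun hw =>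
  h.ne_of_insert h' (Bool.eq_of_ne_of_ne (hw.ne_of_insert hxw)
    ((h.symm.trans hw).ne_of_insert hyw))

/-- The case in which an alternation of `r` is visible only with the help of the last row `p`. -/
theorem hasPattern_of_conflict {Q : Set (X → Bool)} (hQ : CrossConn Q) {f : X → ℕ}
    (hf : ∀ q ∈ Q, ArcRow f q) {p r q₀ : X → Bool} (hp : ArcRow f p) (hq₀ : q₀ ∈ Q)
    (hcross : Cross p q₀) (hr : NotAlternating Q f r) {a b c d : X} (h : Alternate f a b c d)
    (hab : SameAtom Q a b) (ab : ¬ SameAtom (insert p Q) a b)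
    (ac : ¬ SameAtom (insert p Q) a c) (ad : ¬ SameAtom (insert p Q) a d)
    (bc : ¬ SameAtom (insert p Q) b c) (bd : ¬ SameAtom (insert p Q) b d)
    (cd : ¬ SameAtom (insert p Q) c d) (rc : r c = r a) (rd : r d = r b) (rab : r a ≠ r b) :
    HasPattern (insert p (insert r Q)) := by
  have pab := hab.ne_of_insert ab
  have hac := hab.not_sameAtom_insert ab ac bc
  have had := hab.not_sameAtom_insert ab ad bd
  by_cases pc : p c = p a
  · by_cases pd : p d = p a
    · exact hasPattern_of_conflict_same_side hQ hf hp hq₀ hcross hr h hab hac had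
        (fun hcd => hcd.ne_of_insert cd (pc.trans pd.symm)) pab pc pd rc rd rab
    · exact absurd (hp.not_alternate h pc.symm (Bool.eq_of_ne_of_ne pab.symm pd)) pab
  · have pc' := Bool.eq_of_ne_of_ne pc pab.symm
    by_cases pd : p d = p a
    · exact hasPattern_of_split_atom hQ hab pab rab ⟨pc', rc⟩ ⟨pd, rd⟩ hac had
    · have pd' := Bool.eq_of_ne_of_ne pd pab.symm
      exact hasPattern_of_conflict_same_side hQ hf hp hq₀ hcross hr h.reflect hab.symm
        (fun h => had (hab.trans h)) (fun h => hac (hab.trans h))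
        (fun hdc => hdc.symm.ne_of_insert cd (pc'.trans pd'.symm)) pab.symm pd' pc' rd rc rab.symm

/-- In a circular order in which the rows of a crossing-connected family are arcs, a further row
alternates on four separated elements only if there is a forbidden pattern. -/
theorem notAlternating_of_not_hasPattern {P : Set (X → Bool)} (hP : CrossConn P) {f : X → ℕ}
    (hf : ∀ q ∈ P, ArcRow f q) {r : X → Bool} (hno : ¬ HasPattern (insert r P)) :
    NotAlternating P f r := by
  induction hP with
  | single q =>
    intro a b c d _ ab ac _ bc _ _ _ _
    simp only [SameAtom, Set.mem_singleton_iff, forall_eq] at ab ac bc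
    exact absurd (Bool.eq_of_ne_of_ne ac bc) ab
  | @insert p Q q₀ hQ hq₀ hcross ih =>
    have hfQ : ∀ q ∈ Q, ArcRow f q := fun q hq => hf q (Or.inr hq)
    have hp := hf p (Or.inl rfl)
    have hr : NotAlternating Q f r :=
      ih hfQ fun h => hno (h.mono (Set.insert_subset_insert (Set.subset_insert p Q)))
    rw [Set.insert_comm] at hno
    have symm : ∀ {x y}, ¬ SameAtom (insert p Q) x y → ¬ SameAtom (insert p Q) y x :=
      fun h h' => h h'.symm
    intro a b c d h ab ac ad bc bd cd hac hbd
    by_contra rab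
    have rbc : r b ≠ r c := fun e => rab (hac.trans e.symm)
    have core := fun {a b c d} h hab ab ac ad bc bd cd rc rd rab =>
      hno (hasPattern_of_conflict (r := r) (a := a) (b := b) (c := c) (d := d) hQ hfQ hp hq₀
        hcross hr h hab ab ac ad bc bd cd rc rd rab)
    have h1 : ¬ SameAtom Q a b := fun H => core h H ab ac ad bc bd cd hac.symm hbd.symm rab
    have h2 : ¬ SameAtom Q b c := fun H => core h.rotate H bc bd (symm ab) cd (symm ac) (symm ad)
      hbd.symm hac rbc
    have h3 : ¬ SameAtom Q c d := fun H => core h.rotate.rotate H cd (symm ac) (symm bc) (symm ad)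
      (symm bd) ab hac hbd (by rw [← hac, ← hbd]; exact rab)
    have h4 : ¬ SameAtom Q a d := fun H => core h.rotate.rotate.rotate H.symm (symm ad) (symm bd)
      (symm cd) ab ac bc hbd hac.symm (by rw [← hbd]; exact Ne.symm rab)
    have h5 : ¬ SameAtom Q a c := fun H => by
      rcases H.contiguous hQ hfQ h with H' | H'
      · exact h1 H'
      · exact h4 H'
    have h6 : ¬ SameAtom Q b d := fun H => by
      rcases H.contiguous hQ hfQ h.rotate with H' | H'
      · exact h2 H'
      · exact h1 H'.symm
    exact rab (hr a b c d h h1 h5 h4 h2 h6 h3 hac hbd)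

end Key

/-! ### Building a circular order -/

section Build

variable {X : Type*}

/-- A circular order can be cut open at any element `o`: each arc, on its side that avoids `o`,
becomes an interval. -/
theorem exists_cut [Finite X] (f : X → ℕ) (o : X) : ∃ g : X → ℕ, (∀ x y, g x = g y ↔ f x = f y) ∧
    (∀ x, g o ≤ g x) ∧ ∀ R, ArcRow f R → ∀ a b c, R a ≠ R o → R c ≠ R o → g a ≤ g b → g b ≤ g c →
      R b ≠ R o := by
  obtain ⟨N, hN⟩ := (Set.finite_range f).bddAbove
  have hN' : ∀ x, f x ≤ N := fun x => hN ⟨x, rfl⟩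
  refine ⟨fun x => if f o ≤ f x then f x - f o else f x + (N + 1) - f o, ?_, ?_, ?_⟩
  · intro x y
    have := hN' x
    have := hN' y
    have := hN' o
    dsimp only
    split_ifs <;> omega
  · intro x
    simp
  · intro R hR a b c ha hc hab hbc hb
    have h1 : f a ≠ f b := fun h => ha ((hR.eq_of_eq h).trans hb)
    have h2 : f c ≠ f b := fun h => hc ((hR.eq_of_eq h).trans hb)
    have h3 : f a ≠ f o := fun h => ha (hR.eq_of_eq h)
    have h4 : f c ≠ f o := fun h => hc (hR.eq_of_eq h)
    have key : Alternate f o a b c := by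
      have := hN' a
      have := hN' b
      have := hN' c
      have := hN' o
      dsimp only at hab hbc
      rcases le_or_gt (f o) (f a) with ka | ka <;> rcases le_or_gt (f o) (f b) with kb | kb <;>
      rcases le_or_gt (f o) (f c) with kc | kc <;>
      simp only [ka, kb, kc, if_true, if_false, not_le.2] at hab hbc <;>
      first
        | (exfalso; omega)
        | exact Or.inl (by omega)
        | exact Or.inr (Or.inl (by omega))
        | exact Or.inr (Or.inr (Or.inl (by omega)))
        | exact Or.inr (Or.inr (Or.inr (Or.inl (by omega))))
    exact ha (hR.not_alternate key hb.symm (Bool.eq_of_ne_of_ne ha hc)).symm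

theorem alternate_of_ne {f : X → ℕ} {a b c d : X} (h1 : f a ≠ f b) (h2 : f a ≠ f c)
    (h3 : f a ≠ f d) (h4 : f b ≠ f c) (h5 : f b ≠ f d) (h6 : f c ≠ f d) :
    Alternate f a b c d ∨ Alternate f a c b d ∨ Alternate f a b d c := by
  unfold Alternate
  rcases lt_or_gt_of_ne h1 with h1 | h1 <;> rcases lt_or_gt_of_ne h2 with h2 | h2 <;>
  rcases lt_or_gt_of_ne h3 with h3 | h3 <;> rcases lt_or_gt_of_ne h4 with h4 | h4 <;>
  rcases lt_or_gt_of_ne h5 with h5 | h5 <;> rcases lt_or_gt_of_ne h6 with h6 | h6 <;>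
  simp only [h1, h2, h3, h4, h5, h6, true_and, and_true, true_or, or_true]

/-- A row that does not alternate with respect to a crossing-connected family of arcs becomes an
arc after rearranging the elements inside the atoms of the family. -/
theorem exists_arcs_insert [Finite X] {Q : Set (X → Bool)}
    (hQ2 : ∃ q ∈ Q, ∃ q' ∈ Q, Cross q q') {f : X → ℕ} (hf : ∀ q ∈ Q, ArcRow f q) {r : X → Bool}
    (hr : ∀ f, (∀ q ∈ Q, ArcRow f q) → NotAlternating Q f r) :
    ∃ g, ∀ q ∈ insert r Q, ArcRow g q := by
  classical
  -- an order that is constant on the atoms of `Q`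
  obtain ⟨f, hf, hfs⟩ : ∃ f : X → ℕ, (∀ q ∈ Q, ArcRow f q) ∧
      ∀ x y, f x = f y ↔ SameAtom Q x y := by
    let S : Setoid X := ⟨SameAtom Q, fun _ _ _ => rfl, SameAtom.symm, SameAtom.trans⟩
    have hrep : ∀ x, SameAtom Q x (Quotient.out (Quotient.mk S x)) := fun x =>
      SameAtom.symm (Quotient.mk_out (s := S) x)
    refine ⟨fun x => f (Quotient.out (Quotient.mk S x)), ?_, ?_⟩
    · intro q hq
      obtain ⟨v, hv⟩ := hf q hq
      refine ⟨v, fun a b c ha hc hab hbc => ?_⟩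
      rw [hrep a q hq] at ha
      rw [hrep c q hq] at hc
      rw [hrep b q hq]
      exact hv _ _ _ ha hc hab hbc
    · intro x y
      constructor
      · intro h
        exact (hrep x).trans (SameAtom.trans (fun q hq => (hf q hq).eq_of_eq h) (hrep y).symm)
      · intro h
        have : Quotient.mk S x = Quotient.mk S y := Quotient.sound h
        simp only [this]
  have hne : ∀ {x y}, f x ≠ f y → ¬ SameAtom Q x y := fun h h' => h ((hfs _ _).2 h')
  -- an element whose atom is not split by `r`: the four parts of two crossing rows lie in different
  -- atoms, on which `r` would alternate if it split all of them
  obtain ⟨o, ho⟩ : ∃ o, ∀ x, SameAtom Q o x → r x = r o := by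
    by_contra! hsplit
    have hval : ∀ o v, ∃ x, f x = f o ∧ r x = v := by
      intro o v
      by_cases h : r o = v
      · exact ⟨o, rfl, h⟩
      · obtain ⟨x, hx, hxo⟩ := hsplit o
        exact ⟨x, ((hfs _ _).2 hx).symm, Bool.eq_of_ne_of_ne hxo (Ne.symm h)⟩
    have key : ∀ a b c d, ¬ Alternate f a b c d := by
      intro a b c d h
      obtain ⟨a', ha, ra⟩ := hval a true
      obtain ⟨b', hb, rb⟩ := hval b false
      obtain ⟨c', hc, rc⟩ := hval c true
      obtain ⟨d', hd, rd⟩ := hval d false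
      have h' : Alternate f a' b' c' d' := by
        unfold Alternate at *
        rwa [ha, hb, hc, hd]
      obtain ⟨h1, h2, h3, h4, h5, h6⟩ := h'.ne
      have := hr f hf a' b' c' d' h' (hne h1) (hne h2) (hne h3) (hne h4) (hne h5) (hne h6)
        (ra.trans rc.symm) (rb.trans rd.symm)
      simp [ra, rb] at this
    obtain ⟨q, hq, q', hq', hc⟩ := hQ2
    obtain ⟨a, ha, ha'⟩ := hc true true
    obtain ⟨b, hb, hb'⟩ := hc true false
    obtain ⟨c, hc1, hc'⟩ := hc false true
    obtain ⟨d, hd, hd'⟩ := hc false false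
    have e := fun x y => (hf q hq).eq_of_eq (a := x) (b := y)
    have e' := fun x y => (hf q' hq').eq_of_eq (a := x) (b := y)
    have h1 : f a ≠ f b := fun h => by have := e' _ _ h; simp_all
    have h2 : f a ≠ f c := fun h => by have := e _ _ h; simp_all
    have h3 : f a ≠ f d := fun h => by have := e _ _ h; simp_all
    have h4 : f b ≠ f c := fun h => by have := e _ _ h; simp_all
    have h5 : f b ≠ f d := fun h => by have := e _ _ h; simp_all
    have h6 : f c ≠ f d := fun h => by have := e' _ _ h; simp_all
    rcases alternate_of_ne h1 h2 h3 h4 h5 h6 with h | h | h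
    · exact key _ _ _ _ h
    · exact key _ _ _ _ h
    · exact key _ _ _ _ h
  -- cut the order open there
  obtain ⟨g, hgf, hgo, hg⟩ := exists_cut f o
  have hgarc : ∀ q ∈ Q, ArcRow g q := fun q hq => ⟨!q o, fun a b c ha hc hab hbc =>
    Bool.eq_not_iff.2 (hg q (hf q hq) a b c (by simp [ha]) (by simp [hc]) hab hbc)⟩
  have hgne : ∀ {x y}, g x < g y → ¬ SameAtom Q x y := fun h h' =>
    h.ne ((hgf _ _).2 ((hfs _ _).2 h'))
  have hconv : ∀ a b c, g a < g b → g b < g c → r a ≠ r o → r b = r o → r c ≠ r o → False := by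
    intro a b c hab hbc ha hb hc
    have hoa : g o < g a := by
      refine lt_of_le_of_ne (hgo a) fun h => ha ?_
      exact ho a ((hfs _ _).1 ((hgf _ _).1 h))
    have := hr g hgarc o a b c (Or.inl ⟨hoa, hab, hbc⟩) (hgne hoa) (hgne (hoa.trans hab))
      (hgne (hoa.trans (hab.trans hbc))) (hgne hab) (hgne (hab.trans hbc)) (hgne hbc) hb.symm
      (Bool.eq_of_ne_of_ne ha hc)
    exact ha this.symm
  -- inside its first atom the side of `r` avoiding `o` comes last, inside all others first
  set m := sInf {n | ∃ x, g x = n ∧ r x ≠ r o} with hm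
  have hmle : ∀ x, r x ≠ r o → m ≤ g x := fun x hx => Nat.sInf_le ⟨x, rfl, hx⟩
  refine ⟨fun x => 2 * g x + if g x = m then (if r x = r o then 0 else 1)
    else (if r x = r o then 1 else 0), ?_⟩
  rintro q (rfl | hq)
  · refine ⟨!q o, fun a b c ha hc hab hbc => ?_⟩
    have ha' : q a ≠ q o := by simp [ha]
    have hc' : q c ≠ q o := by simp [hc]
    by_contra hb
    have hb' : q b = q o := by simpa using hb
    have h1 := hmle a ha'
    have h2 := hmle c hc'
    obtain ⟨z, hz, hzo⟩ : ∃ x, g x = m ∧ q x ≠ q o :=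
      Nat.sInf_mem (s := {n | ∃ x, g x = n ∧ q x ≠ q o}) ⟨g a, a, rfl, ha'⟩
    have k1 := hconv a b c
    have k2 := hconv z b c
    simp only [ha', hb', hc', hzo, ne_eq, not_false_eq_true, forall_const, imp_false,
      if_true, if_false, not_lt] at hab hbc k1 k2
    split_ifs at hab hbc <;> omega
  · refine ⟨!q o, fun a b c ha hc hab hbc => ?_⟩
    have key : ∀ x y, (2 * g x + if g x = m then (if r x = r o then 0 else 1)
        else (if r x = r o then 1 else 0)) ≤ (2 * g y + if g y = m then (if r y = r o then 0 else 1)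
        else (if r y = r o then 1 else 0)) → g x ≤ g y := by
      intro x y h
      split_ifs at h <;> omega
    exact Bool.eq_not_iff.2
      (hg q (hf q hq) a b c (by simp [ha]) (by simp [hc]) (key a b hab) (key b c hbc))

theorem CrossConn.exists_arcs [Finite X] {C : Set (X → Bool)} (hC : CrossConn C)
    (hno : ¬ HasPattern C) : ∃ f, ∀ q ∈ C, ArcRow f q := by
  induction hC with
  | single r =>
    refine ⟨fun x => if r x then 1 else 0, ?_⟩
    rintro q rfl
    refine ⟨true, fun a b c ha hc hab hbc => ?_⟩
    by_contra hb
    simp [ha, hb] at hab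
  | insert r q hQ hq hc ih =>
    rcases hQ.singleton_or_cross with ⟨s, rfl⟩ | hQ2
    · -- two rows: the four parts they cut out, in circular order
      refine ⟨fun x => if s x then (if r x then 1 else 0) else (if r x then 2 else 3), ?_⟩
      rintro q (rfl | rfl)
      · refine ⟨true, fun a b c ha hc hab hbc => ?_⟩
        by_contra hb
        cases h1 : s a <;> cases h2 : s b <;> cases h3 : s c <;> simp_all
      · refine ⟨true, fun a b c ha hc hab hbc => ?_⟩
        by_contra hb
        cases h1 : r a <;> cases h2 : r b <;> cases h3 : r c <;> simp_all
    · obtain ⟨f, hf⟩ := ih fun h => hno (h.mono (Set.subset_insert _ _))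
      exact exists_arcs_insert hQ2 hf fun f hf => notAlternating_of_not_hasPattern hQ hf hno

theorem CrossConn.nonempty {C : Set (X → Bool)} (hC : CrossConn C) : C.Nonempty := by
  cases hC with
  | single r => exact ⟨r, rfl⟩
  | insert r q _ _ _ => exact ⟨r, Or.inl rfl⟩

/-- A row that crosses no row of a crossing-connected family is constant outside of some atom: it
is constant on one side of each row of the family, with the same value for crossing rows. -/
theorem CrossConn.exists_atom [Nonempty X] {C : Set (X → Bool)} (hC : CrossConn C) {e : X → Bool}
    (he : ∀ c ∈ C, ¬ Cross e c) :
    ∃ w, ∀ x y, ¬ SameAtom C w x → ¬ SameAtom C w y → e x = e y := by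
  have hside : ∀ c ∈ C, ∃ v t, ∀ x, c x = t → e x = v := by
    intro c hc
    have := he c hc
    simp only [Cross, not_forall, not_exists, not_and] at this
    obtain ⟨s, t, h⟩ := this
    refine ⟨!s, t, fun x hx => ?_⟩
    by_contra hne
    exact h x (by simpa using hne) hx
  obtain ⟨c₀, hc₀⟩ := hC.nonempty
  obtain ⟨v, t₀, h₀⟩ := hside c₀ hc₀
  have hall : ∀ c ∈ C, ∃ t, ∀ x, c x = t → e x = v := by
    intro c hc
    refine hC.propagate (fun c => ∃ t, ∀ x, c x = t → e x = v) ?_ hc₀ hc ⟨t₀, h₀⟩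
    rintro p hp q hq hpq ⟨t, ht⟩
    obtain ⟨v', t', ht'⟩ := hside q hq
    obtain ⟨x, hx, hx'⟩ := hpq t t'
    refine ⟨t', fun y hy => ?_⟩
    rw [ht' y hy, ← ht' x hx', ht x hx]
  by_cases hconst : ∀ x, e x = v
  · exact ⟨Classical.arbitrary X, fun x y _ _ => (hconst x).trans (hconst y).symm⟩
  · push Not at hconst
    obtain ⟨w, hw⟩ := hconst
    have key : ∀ x, ¬ SameAtom C w x → e x = v := by
      intro x hx
      simp only [SameAtom, not_forall] at hx
      obtain ⟨c, hc, hcx⟩ := hx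
      obtain ⟨t, ht⟩ := hall c hc
      exact ht x (Bool.eq_of_ne_of_ne (Ne.symm hcx) fun h => hw (ht w h.symm))
    exact ⟨w, fun x y hx hy => (key x hx).trans (key y hy).symm⟩

/-- Two families of rows that live inside a set and inside its complement can be arranged
independently. -/
theorem exists_arcs_glue [Finite X] {F G : Set (X → Bool)} (A : X → Prop) (i o : X)
    (hF : ∃ f, ∀ q ∈ F, ArcRow f q) (hG : ∃ f, ∀ q ∈ G, ArcRow f q)
    (hFA : ∀ q ∈ F, ∀ x, ¬ A x → q x = q o) (hGA : ∀ q ∈ G, ∀ x, A x → q x = q i) :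
    ∃ f, ∀ q ∈ F ∪ G, ArcRow f q := by
  classical
  obtain ⟨f, hf⟩ := hF
  obtain ⟨g, hg⟩ := hG
  obtain ⟨f', -, -, hf'⟩ := exists_cut f o
  obtain ⟨g', -, -, hg'⟩ := exists_cut g i
  obtain ⟨N, hN⟩ := (Set.finite_range f').bddAbove
  have hN' : ∀ x, f' x ≤ N := fun x => hN ⟨x, rfl⟩
  refine ⟨fun x => if A x then f' x else N + 1 + g' x, ?_⟩
  rintro q (hq | hq)
  · refine ⟨!q o, fun a b c ha hc hab hbc => ?_⟩
    have hA : ∀ x, q x = !q o → A x := fun x hx => by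
      by_contra h
      have := hFA q hq x h
      simp [this] at hx
    have hb : A b := by
      by_contra hb
      have := hN' c
      simp only [hA c hc, hb, if_true, if_false] at hbc
      omega
    simp only [hA a ha, hA c hc, hb, if_true] at hab hbc
    exact Bool.eq_not_iff.2 (hf' q (hf q hq) a b c (by simp [ha]) (by simp [hc]) hab hbc)
  · refine ⟨!q i, fun a b c ha hc hab hbc => ?_⟩
    have hA : ∀ x, q x = !q i → ¬ A x := fun x hx h => by
      have := hGA q hq x h
      simp [this] at hx
    have hb : ¬ A b := by
      intro hb
      have := hN' b
      simp only [hA a ha, hb, if_true, if_false] at hab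
      omega
    simp only [hA a ha, hA c hc, hb, if_false, add_le_add_iff_left] at hab hbc
    exact Bool.eq_not_iff.2 (hg' q (hg q hq) a b c (by simp [ha]) (by simp [hc]) hab hbc)

/-- A finite family of rows without forbidden patterns has a circular order in which all of its
rows are arcs. Unless it is connected under crossing, it falls into the rows living inside an atom
of a maximal crossing-connected subfamily and the rows that do not split this atom. -/
theorem exists_arcs_of_not_hasPattern [Finite X] (F : Finset (X → Bool))
    (hno : ¬ HasPattern (F : Set (X → Bool))) : ∃ f, ∀ q ∈ F, ArcRow f q := by
  classical
  induction F using Finset.strongInduction with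
  | H F ih =>
  have ih' : ∀ G ⊂ F, ∃ f, ∀ q ∈ G, ArcRow f q := fun G hG =>
    ih G hG fun h => hno (h.mono (by exact_mod_cast hG.1))
  by_cases hconst : ∃ r ∈ F, ∀ x y, r x = r y
  · obtain ⟨r, hr, hrc⟩ := hconst
    obtain ⟨f, hf⟩ := ih' _ (Finset.erase_ssubset hr)
    refine ⟨f, fun q hq => ?_⟩
    by_cases h : q = r
    · exact ⟨true, fun a b c ha _ _ _ => by rw [h] at *; rw [hrc b a, ha]⟩
    · exact hf q (Finset.mem_erase.2 ⟨h, hq⟩)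
  push Not at hconst
  rcases F.eq_empty_or_nonempty with rfl | ⟨r, hr⟩
  · exact ⟨fun _ => 0, by simp⟩
  -- a maximal crossing-connected subfamily
  obtain ⟨C, hCmem, hCmax⟩ := Finset.exists_max_image
    (F.powerset.filter fun C : Finset (X → Bool) => CrossConn (C : Set (X → Bool))) Finset.card
    ⟨{r}, by simpa [hr] using CrossConn.single r⟩
  simp only [Finset.mem_filter, Finset.mem_powerset] at hCmem hCmax
  obtain ⟨hCF, hC⟩ := hCmem
  by_cases hCeq : C = F
  · subst hCeq
    exact hC.exists_arcs hno
  obtain ⟨d, hdF, hdC⟩ := Finset.exists_of_ssubset (Finset.ssubset_iff_subset_ne.2 ⟨hCF, hCeq⟩)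
  have hnc : ∀ e ∈ F, e ∉ C → ∀ c ∈ C, ¬ Cross e c := by
    intro e he heC c hc hcr
    have := hCmax (insert e C) ⟨Finset.insert_subset he hCF, by
      rw [Finset.coe_insert]; exact CrossConn.insert e c hC hc hcr⟩
    rw [Finset.card_insert_of_notMem heC] at this
    omega
  obtain ⟨x₀, y₀, hxy₀⟩ := hconst d hdF
  have : Nonempty X := ⟨x₀⟩
  obtain ⟨w, hw⟩ := hC.exists_atom (hnc d hdF hdC)
  obtain ⟨c, hc⟩ := Finset.coe_nonempty.1 hC.nonempty
  obtain ⟨o, ho⟩ : ∃ o, ¬ SameAtom (C : Set (X → Bool)) w o := by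
    by_contra! hall
    obtain ⟨x, y, hxy⟩ := hconst c (hCF hc)
    exact hxy ((hall x c hc).symm.trans (hall y c hc))
  -- the rows that live inside the atom of `w`
  let In : (X → Bool) → Prop := fun q => q ∉ C ∧
    ∀ x, ¬ SameAtom (C : Set (X → Bool)) w x → q x = q o
  obtain ⟨f, hf⟩ := exists_arcs_glue (F := (F.filter In : Finset _))
    (G := (F.filter fun q => ¬ In q : Finset _)) (SameAtom (C : Set (X → Bool)) w)
    w o (ih' _ (Finset.filter_ssubset.2 ⟨c, hCF hc, fun h => h.1 hc⟩))
    (ih' _ (Finset.filter_ssubset.2 ⟨d, hdF, fun h => h ⟨hdC, fun x hx => hw x o hx ho⟩⟩))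
    (fun q hq x hx => by
      rw [Finset.mem_coe, Finset.mem_filter] at hq
      exact hq.2.2 x hx)
    (fun q hq x hx => by
      rw [Finset.mem_coe, Finset.mem_filter] at hq
      obtain ⟨hqF, hq⟩ := hq
      by_cases hqC : q ∈ C
      · exact (hx q hqC).symm
      · obtain ⟨w', hw'⟩ := hC.exists_atom (hnc q hqF hqC)
        by_cases hww : SameAtom (C : Set (X → Bool)) w w'
        · exact absurd ⟨hqC, fun x hx => hw' x o (fun h => hx (hww.trans h))
            (fun h => ho (hww.trans h))⟩ hq
        · exact hw' x w (fun h => hww (hx.trans h.symm)) (fun h => hww h.symm))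
  refine ⟨f, fun q hq => hf q ?_⟩
  by_cases h : In q
  · exact Or.inl (by simpa [h] using hq)
  · exact Or.inr (by simpa [h] using hq)

end Build

/-! ### Arcs and circularly consecutive sets -/

section Translation

theorem ArcRow.comp {X Y : Type*} {f : X → ℕ} {R : X → Bool} (h : ArcRow f R) (σ : Y → X) :
    ArcRow (fun y => f (σ y)) fun y => R (σ y) := by
  obtain ⟨v, hv⟩ := h
  exact ⟨v, fun a b c => hv (σ a) (σ b) (σ c)⟩

theorem ArcRow.xor {X : Type*} {f : X → ℕ} {R : X → Bool} (h : ArcRow f R) (b : Bool) :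
    ArcRow f fun x => xor b (R x) := by
  obtain ⟨v, hv⟩ := h
  refine ⟨Bool.xor b v, fun x y w => ?_⟩
  simpa using hv x y w

theorem circularlyConsecutive_of_iff {n : ℕ} {S : Set (Fin n)} {s l : ℕ} (hs : s < n) (hl : l ≤ n)
    (h : ∀ j : Fin n, j ∈ S ↔ (s ≤ j ∧ (j : ℕ) < s + l) ∨ (j : ℕ) + n < s + l) :
    CircularlyConsecutive S := by
  refine ⟨s, l, fun j => (h j).trans ?_⟩
  have hj := j.2
  constructor
  · rintro (h | h)
    · exact ⟨j - s, by omega, by rw [Nat.mod_eq_of_lt] <;> omega⟩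
    · refine ⟨j + n - s, by omega, ?_⟩
      rw [show s + (j + n - s) = j + n by omega, Nat.add_mod_right, Nat.mod_eq_of_lt hj]
  · rintro ⟨t, ht, hjt⟩
    rcases Nat.lt_or_ge (s + t) n with h' | h'
    · rw [Nat.mod_eq_of_lt h'] at hjt
      omega
    · rw [Nat.mod_eq_sub_mod h', Nat.mod_eq_of_lt (by omega)] at hjt
      omega

theorem CircularlyConsecutive.exists_iff {n : ℕ} {S : Set (Fin n)} (hn : 0 < n)
    (h : CircularlyConsecutive S) : ∃ s l, s < n ∧ l ≤ n ∧
      ∀ j : Fin n, j ∈ S ↔ (s ≤ j ∧ (j : ℕ) < s + l) ∨ (j : ℕ) + n < s + l := by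
  obtain ⟨s, l, h⟩ := h
  have hs : s % n < n := Nat.mod_lt _ hn
  refine ⟨s % n, min l n, hs, min_le_right _ _, fun j => (h j).trans ?_⟩
  have hj := j.2
  constructor
  · rintro ⟨t, ht, hjt⟩
    have ht' : t % n < min l n := by
      have := Nat.mod_lt t hn
      have := Nat.mod_le t n
      omega
    rw [Nat.add_mod] at hjt
    generalize t % n = t' at *
    generalize s % n = s' at *
    rcases Nat.lt_or_ge (s' + t') n with h' | h'
    · rw [Nat.mod_eq_of_lt h'] at hjt
      omega
    · rw [Nat.mod_eq_sub_mod h', Nat.mod_eq_of_lt (by omega)] at hjt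
      omega
  · rintro (h | h)
    · refine ⟨j - s % n, by omega, ?_⟩
      rw [← Nat.mod_add_mod, show s % n + (j - s % n) = j by omega, Nat.mod_eq_of_lt hj]
    · refine ⟨j + n - s % n, by omega, ?_⟩
      rw [← Nat.mod_add_mod, show s % n + (j + n - s % n) = j + n by omega, Nat.add_mod_right,
        Nat.mod_eq_of_lt hj]

/-- A nonempty set of positions that is convex is an interval. -/
theorem exists_interval {n : ℕ} {P : Fin n → Prop} (hne : ∃ j, P j)
    (hconv : ∀ a b c, P a → P c → a ≤ b → b ≤ c → P b) :
    ∃ m M : ℕ, m ≤ M ∧ M < n ∧ ∀ j : Fin n, P j ↔ m ≤ j ∧ (j : ℕ) ≤ M := by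
  classical
  have hF : (Finset.univ.filter P).Nonempty := by
    obtain ⟨j, hj⟩ := hne
    exact ⟨j, by simpa using hj⟩
  have h1 := Finset.min'_mem _ hF
  have h2 := Finset.max'_mem _ hF
  simp only [Finset.mem_filter, Finset.mem_univ, true_and] at h1 h2
  refine ⟨(Finset.univ.filter P).min' hF, (Finset.univ.filter P).max' hF,
    Finset.min'_le_max' _ hF, Fin.is_lt _, fun j => ⟨fun hj => ?_, fun hj => ?_⟩⟩
  · have hmem : j ∈ Finset.univ.filter P := by simpa using hj
    exact ⟨Finset.min'_le _ _ hmem, Finset.le_max' _ _ hmem⟩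
  · exact hconv _ j _ h1 h2 hj.1 hj.2

theorem circularlyConsecutive_iff_arcRow {n : ℕ} (R : Fin n → Bool) :
    CircularlyConsecutive {p | R p = true} ↔ ArcRow (fun p : Fin n => (p : ℕ)) R := by
  rcases Nat.eq_zero_or_pos n with rfl | hn
  · exact iff_of_true ⟨0, 0, fun j => j.elim0⟩ ⟨true, fun a => a.elim0⟩
  constructor
  · intro h
    obtain ⟨s, l, hs, hl, h⟩ := h.exists_iff hn
    simp only [Set.mem_ofPred_eq] at h
    rcases Nat.lt_or_ge n (s + l) with h' | h'
    · refine ⟨false, fun a b c ha hc hab hbc => ?_⟩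
      rw [← Bool.not_eq_true, h] at ha hc ⊢
      dsimp only at hab hbc
      omega
    · refine ⟨true, fun a b c ha hc hab hbc => ?_⟩
      rw [h] at ha hc ⊢
      dsimp only at hab hbc
      omega
  · rintro ⟨v, hv⟩
    by_cases hne : ∃ j, R j = v
    · obtain ⟨m, M, hmM, hM, h⟩ := exists_interval hne hv
      cases v
      · have h' : ∀ j, R j = true ↔ ¬ (m ≤ j ∧ (j : ℕ) ≤ M) := fun j => by simp [← h j]
        rcases Nat.lt_or_ge (M + 1) n with hM' | hM'
        · refine circularlyConsecutive_of_iff (s := M + 1) (l := n - (M + 1 - m)) hM' (by omega)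
            fun j => (h' j).trans ?_
          have := j.2
          omega
        · refine circularlyConsecutive_of_iff (s := 0) (l := m) hn (by omega)
            fun j => (h' j).trans ?_
          have := j.2
          omega
      · refine circularlyConsecutive_of_iff (s := m) (l := M + 1 - m) (by omega) (by omega)
          fun j => (h j).trans ?_
        omega
    · push Not at hne
      cases v
      · refine circularlyConsecutive_of_iff (s := 0) (l := n) hn le_rfl fun j => ?_
        have := hne j
        have := j.2
        simp_all
      · refine circularlyConsecutive_of_iff (s := 0) (l := 0) hn (by omega) fun j => ?_
        simpa using hne j

end Translation

/-! ### Matrices and their configurations -/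

namespace BinMatrix

/-- An injective arrangement is not needed: ties of `f` are broken by sorting. -/
theorem circularOnesRows_iff (M : BinMatrix) :
    M.CircularOnesRows ↔ ∃ f : Fin M.cols → ℕ, ∀ i, ArcRow f (M.entry i) := by
  constructor
  · rintro ⟨π, hπ⟩
    refine ⟨fun j => π.symm j, fun i => ?_⟩
    have := ((circularlyConsecutive_iff_arcRow fun p => M.entry i (π p)).1 (hπ i)).comp π.symm
    simpa using this
  · rintro ⟨f, hf⟩
    refine ⟨Tuple.sort f, fun i => (circularlyConsecutive_iff_arcRow _).2 ?_⟩
    obtain ⟨v, hv⟩ := hf i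
    have hmono := Tuple.monotone_sort f
    exact ⟨v, fun a b c ha hc hab hbc => hv _ _ _ ha hc (hmono hab) (hmono hbc)⟩

/-- Since rows and columns may be permuted, the order of the selected ones is irrelevant. -/
theorem containsConfiguration_iff (M N : BinMatrix) :
    M.ContainsConfiguration N ↔ ∃ (ρ : Fin N.rows → Fin M.rows) (σ : Fin N.cols → Fin M.cols),
      Function.Injective ρ ∧ Function.Injective σ ∧
        ∀ i j, N.entry i j = M.entry (ρ i) (σ j) := by
  constructor
  · rintro ⟨S, ⟨ρ, σ, h⟩, e, f, h'⟩
    refine ⟨fun i => ρ (e.symm i), fun j => σ (f.symm j), ρ.injective.comp e.symm.injective,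
      σ.injective.comp f.symm.injective, fun i j => ?_⟩
    rw [← h, h']
    simp
  · rintro ⟨ρ, σ, hρ, hσ, h⟩
    refine ⟨⟨N.rows, N.cols, fun i j => N.entry (Tuple.sort ρ i) (Tuple.sort σ j)⟩,
      ⟨OrderEmbedding.ofStrictMono (ρ ∘ Tuple.sort ρ) ?_,
        OrderEmbedding.ofStrictMono (σ ∘ Tuple.sort σ) ?_, fun i j => ?_⟩,
      Tuple.sort ρ, Tuple.sort σ, fun i j => rfl⟩
    · exact (Tuple.monotone_sort ρ).strictMono_of_injective
        (hρ.comp (Tuple.sort ρ).injective)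
    · exact (Tuple.monotone_sort σ).strictMono_of_injective
        (hσ.comp (Tuple.sort σ).injective)
    · exact h _ _

theorem ContainsConfiguration.trans {M N K : BinMatrix} (h : M.ContainsConfiguration N)
    (h' : N.ContainsConfiguration K) : M.ContainsConfiguration K := by
  rw [containsConfiguration_iff] at *
  obtain ⟨ρ, σ, hρ, hσ, h⟩ := h
  obtain ⟨ρ', σ', hρ', hσ', h'⟩ := h'
  exact ⟨ρ ∘ ρ', σ ∘ σ', hρ.comp hρ', hσ.comp hσ', fun i j => (h' i j).trans (h _ _)⟩

theorem ContainsConfiguration.transpose {M N : BinMatrix} (h : M.ContainsConfiguration N) :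
    M.transpose.ContainsConfiguration N.transpose := by
  rw [containsConfiguration_iff] at *
  obtain ⟨ρ, σ, hρ, hσ, h⟩ := h
  exact ⟨σ, ρ, hσ, hρ, fun i j => h j i⟩

theorem CircularOnesRowsCols.of_maps {M N : BinMatrix} (hM : M.CircularOnesRowsCols)
    (ρ : Fin N.rows → Fin M.rows) (σ : Fin N.cols → Fin M.cols)
    (h : ∀ i j, N.entry i j = M.entry (ρ i) (σ j)) : N.CircularOnesRowsCols := by
  simp only [CircularOnesRowsCols, CircularOnesCols, circularOnesRows_iff] at *
  obtain ⟨⟨f, hf⟩, g, hg⟩ := hM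
  refine ⟨⟨fun j => f (σ j), fun i => ?_⟩, fun i => g (ρ i), fun j => ?_⟩
  · have := (hf (ρ i)).comp σ
    rwa [show (fun j => M.entry (ρ i) (σ j)) = N.entry i from funext fun j => (h i j).symm] at this
  · have := (hg (σ j)).comp ρ
    rwa [show (fun i => M.transpose.entry (σ j) (ρ i)) = N.transpose.entry j from
      funext fun i => (h i j).symm] at this

theorem CircularOnesRowsCols.of_containsConfiguration {M N : BinMatrix}
    (hM : M.CircularOnesRowsCols) (h : M.ContainsConfiguration N) : N.CircularOnesRowsCols := by
  rw [containsConfiguration_iff] at h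
  obtain ⟨ρ, σ, -, -, h⟩ := h
  exact hM.of_maps ρ σ h

theorem circularOnesRows_of_not_hasPattern {M : BinMatrix}
    (h : ¬ HasPattern (Set.range M.entry)) : M.CircularOnesRows := by
  rw [circularOnesRows_iff]
  obtain ⟨f, hf⟩ := exists_arcs_of_not_hasPattern (Set.finite_range M.entry).toFinset
    (by simpa using h)
  exact ⟨f, fun i => hf _ ((Set.Finite.mem_toFinset _).2 ⟨i, rfl⟩)⟩

end BinMatrix

/-- Rows that form a cycle pattern are not simultaneously arcs: cut the circle at the additional
element and look at the two neighbours of the first element of the cycle. -/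
theorem CyclePattern.not_arcs {X : Type*} [Finite X] {F : Set (X → Bool)} {k : ℕ} (hk : 3 ≤ k)
    (h : CyclePattern F k) : ¬ ∃ f, ∀ q ∈ F, ArcRow f q := by
  rintro ⟨f, hf⟩
  obtain ⟨R, z, o, hR, hz⟩ := h
  obtain ⟨g, -, -, hg⟩ := exists_cut f o
  obtain ⟨m, hm, hmin⟩ := Finset.exists_min_image (Finset.range k) (fun i => g (z i))
    ⟨0, by simp; omega⟩
  simp only [Finset.mem_range] at hm hmin
  -- the predecessor of `m` on the cycle
  obtain ⟨l, hl, hlm⟩ : ∃ l < k, (l + 1) % k = m := by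
    rcases Nat.eq_zero_or_pos m with rfl | h
    · exact ⟨k - 1, by omega, by rw [Nat.sub_add_cancel (by omega), Nat.mod_self]⟩
    · exact ⟨m - 1, by omega, by rw [Nat.sub_add_cancel h, Nat.mod_eq_of_lt hm]⟩
  have hu : (m + 1) % k < k := Nat.mod_lt _ (by omega)
  have hlm' : l + 1 = m ∨ l + 1 = k ∧ m = 0 := by
    rcases Nat.lt_or_ge (l + 1) k with h | h
    · rw [Nat.mod_eq_of_lt h] at hlm; exact Or.inl hlm
    · have : l + 1 = k := by omega
      rw [this, Nat.mod_self] at hlm; exact Or.inr ⟨this, hlm.symm⟩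
  have hu' : (m + 1) % k = m + 1 ∨ m + 1 = k ∧ (m + 1) % k = 0 := by
    rcases Nat.lt_or_ge (m + 1) k with h | h
    · exact Or.inl (Nat.mod_eq_of_lt h)
    · have : m + 1 = k := by omega
      exact Or.inr ⟨this, by rw [this, Nat.mod_self]⟩
  rcases le_total (g (z l)) (g (z ((m + 1) % k))) with h | h
  · have := hg _ (hf _ (hR m hm)) _ _ _ ((hz m hm m hm).2 (Or.inl rfl))
      ((hz m hm _ hu).2 (Or.inr rfl)) (hmin l hl) h
    rw [hz m hm l hl] at this
    omega
  · have := hg _ (hf _ (hR l hl)) _ _ _ ((hz l hl m hm).2 (Or.inr hlm.symm))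
      ((hz l hl l hl).2 (Or.inl rfl)) (hmin _ hu) h
    rw [hz l hl _ hu, hlm] at this
    omega

/-- Rows that form a transversal pattern are not simultaneously arcs: after cutting the circle at
`c'`, the values of the four rows at the pairs exclude every order of the remaining elements. -/
theorem TransversalPattern.not_arcs {X : Type*} [Finite X] {F : Set (X → Bool)}
    (h : TransversalPattern F) : ¬ ∃ f, ∀ q ∈ F, ArcRow f q := by
  rintro ⟨f, hf⟩
  obtain ⟨q₁, h₁, q₂, h₂, q₃, h₃, t, ht, a, a', b, b', c, c', H1, H2, H3, H4⟩ := h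
  obtain ⟨g, -, -, hg⟩ := exists_cut f c'
  have k1 := hg q₁ (hf _ h₁)
  have k2 := hg q₂ (hf _ h₂)
  have k3 := hg q₃ (hf _ h₃)
  have k4 := hg t (hf _ ht)
  have e1 : q₁ b = q₁ c' := Bool.eq_of_ne_of_ne H1.2.1 H1.2.2.2.2
  have e2 : q₂ a = q₂ c' := Bool.eq_of_ne_of_ne H2.2.1 H2.2.2.2.2
  have e3 : t a' = t c' := Bool.eq_of_ne_of_ne H4.2.2.1 H4.2.2.2.2
  have e4 : t b' = t c' := Bool.eq_of_ne_of_ne H4.2.2.2.1 H4.2.2.2.2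
  have n1 : q₁ a ≠ q₁ c' := H1.2.2.2.2.symm
  have n1' : q₁ a' ≠ q₁ c' := H1.1 ▸ n1
  have n2 : q₂ b ≠ q₂ c' := H2.2.2.2.2.symm
  have n2' : q₂ b' ≠ q₂ c' := H2.1 ▸ n2
  have e5 : q₃ c = q₃ c' := H3.1.symm
  have n3 : q₃ a ≠ q₃ c' := e5 ▸ H3.2.1
  have n4 : q₃ b ≠ q₃ c' := e5 ▸ H3.2.2.2.1
  have n5 : t a ≠ t c' := H4.2.2.2.2.symm
  have n6 : t b ≠ t c' := H4.1 ▸ n5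
  have n7 : t c ≠ t c' := H4.2.1 ▸ n5
  have n8 : q₃ a' ≠ q₃ c' := e5 ▸ H3.2.2.1
  have n9 : q₃ b' ≠ q₃ c' := e5 ▸ H3.2.2.2.2
  have l1 : ¬ (g a ≤ g b ∧ g b ≤ g a') := fun h => k1 _ _ _ n1 n1' h.1 h.2 e1
  have l2 : ¬ (g a' ≤ g b ∧ g b ≤ g a) := fun h => k1 _ _ _ n1' n1 h.1 h.2 e1
  have l3 : ¬ (g b ≤ g a ∧ g a ≤ g b') := fun h => k2 _ _ _ n2 n2' h.1 h.2 e2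
  have l4 : ¬ (g b' ≤ g a ∧ g a ≤ g b) := fun h => k2 _ _ _ n2' n2 h.1 h.2 e2
  have l5 : ¬ (g a ≤ g c ∧ g c ≤ g b) := fun h => k3 _ _ _ n3 n4 h.1 h.2 e5
  have l6 : ¬ (g b ≤ g c ∧ g c ≤ g a) := fun h => k3 _ _ _ n4 n3 h.1 h.2 e5
  have l7 : ¬ (g a ≤ g c ∧ g c ≤ g a') := fun h => k3 _ _ _ n3 n8 h.1 h.2 e5
  have l8 : ¬ (g a' ≤ g c ∧ g c ≤ g a) := fun h => k3 _ _ _ n8 n3 h.1 h.2 e5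
  have l9 : ¬ (g b ≤ g c ∧ g c ≤ g b') := fun h => k3 _ _ _ n4 n9 h.1 h.2 e5
  have l10 : ¬ (g b' ≤ g c ∧ g c ≤ g b) := fun h => k3 _ _ _ n9 n4 h.1 h.2 e5
  have l11 : ¬ (g a ≤ g a' ∧ g a' ≤ g c) := fun h => k4 _ _ _ n5 n7 h.1 h.2 e3
  have l12 : ¬ (g c ≤ g a' ∧ g a' ≤ g a) := fun h => k4 _ _ _ n7 n5 h.1 h.2 e3
  have l13 : ¬ (g b ≤ g b' ∧ g b' ≤ g c) := fun h => k4 _ _ _ n6 n7 h.1 h.2 e4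
  have l14 : ¬ (g c ≤ g b' ∧ g b' ≤ g b) := fun h => k4 _ _ _ n7 n6 h.1 h.2 e4
  have l15 : ¬ (g a ≤ g b' ∧ g b' ≤ g b) := fun h => k4 _ _ _ n5 n6 h.1 h.2 e4
  have l16 : ¬ (g b ≤ g a' ∧ g a' ≤ g a) := fun h => k4 _ _ _ n6 n5 h.1 h.2 e3
  have l17 : ¬ (g a ≤ g a' ∧ g a' ≤ g b) := fun h => k4 _ _ _ n5 n6 h.1 h.2 e3
  have l18 : ¬ (g b ≤ g b' ∧ g b' ≤ g a) := fun h => k4 _ _ _ n6 n5 h.1 h.2 e4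
  clear * - l1 l2 l3 l4 l5 l6 l7 l8 l9 l10 l11 l12 l13 l14 l15 l16 l17 l18
  omega

/-! ### Complemented cycle matrices -/

namespace BinMatrix

/-- Whether row `i` of `M_I(k)*` has a one in column `j`; the column of zeros is column `k`. -/
def cycleEntry (k i j : ℕ) : Bool := decide (j < k ∧ (j = i ∨ j = (i + 1) % k))

/-- The matrix `a ⊙ M_I(k)*`. -/
def cycleMatrix (k : ℕ) (a : Fin k → Bool) : BinMatrix :=
  ⟨k, k + 1, fun i j => xor (a i) (cycleEntry k i j)⟩

theorem MIast_entry (k : ℕ) (i : Fin k) (j : Fin (k + 1)) :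
    (MIast k).entry i j = cycleEntry k i j := by
  simp only [MIast, addZeroCol, MI, cycleEntry]
  by_cases h : (j : ℕ) < k <;> simp [h]

theorem complRows_MIast (k : ℕ) (a : Fin k → Bool) :
    (MIast k).complRows a = cycleMatrix k a := by
  unfold complRows cycleMatrix
  congr 1
  funext i j
  exact congrArg _ (MIast_entry k i j)

theorem MIast_eq (k : ℕ) : MIast k = cycleMatrix k fun _ => false := by
  rw [← complRows_MIast]
  unfold complRows
  simp

theorem compl_MIast_eq (k : ℕ) : (MIast k).compl = cycleMatrix k fun _ => true := by
  rw [← complRows_MIast]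
  unfold complRows compl
  simp

theorem mem_forbRowCol {N : BinMatrix} : N ∈ ForbRowCol ↔
    (∃ k b, 3 ≤ k ∧ N = cycleMatrix k fun _ => b) ∨
    (∃ l ∈ ARowCol, N = cycleMatrix l.length l.get) ∨ N = MVast ∨ N = MVast.compl := by
  simp only [ForbRowCol, Set.mem_union, Set.mem_ofPred_eq, Set.mem_insert_iff,
    Set.mem_singleton_iff, MIast_eq, or_assoc]
  constructor
  · rintro (⟨k, hk, h | h⟩ | ⟨l, hl, h⟩ | h)
    · exact Or.inl ⟨k, false, hk, h⟩
    · exact Or.inl ⟨k, true, hk, by rw [h, ← MIast_eq, compl_MIast_eq]⟩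
    · exact Or.inr (Or.inl ⟨l, hl, by rw [h, ← complRows_MIast]⟩)
    · exact Or.inr (Or.inr h)
  · rintro (⟨k, b, hk, h⟩ | ⟨l, hl, h⟩ | h)
    · refine Or.inl ⟨k, hk, ?_⟩
      cases b
      · exact Or.inl h
      · exact Or.inr (by rw [h, ← MIast_eq, compl_MIast_eq])
    · exact Or.inr (Or.inl ⟨l, hl, by rw [h, ← complRows_MIast]⟩)
    · exact Or.inr (Or.inr h)

theorem transpose_mem_forbRowColSymm {N : BinMatrix} (h : N ∈ ForbRowColSymm) :
    N.transpose ∈ ForbRowColSymm := by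
  rcases h with h | ⟨K, hK, rfl⟩
  · exact Or.inr ⟨N, h, rfl⟩
  · exact Or.inl hK

/-- `M` contains a matrix of `ForbRowColSymm` as a configuration. -/
def ContainsForbidden (M : BinMatrix) : Prop :=
  ∃ N ∈ ForbRowColSymm, M.ContainsConfiguration N

theorem ContainsForbidden.of_contains {M N : BinMatrix} (h : M.ContainsConfiguration N)
    (hN : N.ContainsForbidden) : M.ContainsForbidden := by
  obtain ⟨K, hK, h'⟩ := hN
  exact ⟨K, hK, h.trans h'⟩

theorem ContainsForbidden.transpose {M : BinMatrix} (h : M.ContainsForbidden) :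
    M.transpose.ContainsForbidden := by
  obtain ⟨K, hK, h'⟩ := h
  exact ⟨K.transpose, transpose_mem_forbRowColSymm hK, h'.transpose⟩

theorem ContainsConfiguration.refl (M : BinMatrix) : M.ContainsConfiguration M :=
  (containsConfiguration_iff M M).2
    ⟨id, id, Function.injective_id, Function.injective_id, fun _ _ => rfl⟩

theorem ContainsForbidden.of_mem {M : BinMatrix} (h : M ∈ ForbRowCol) : M.ContainsForbidden :=
  ⟨M, Or.inl h, ContainsConfiguration.refl M⟩

/-- On a cycle of length at least three, two elements are not successors of each other. -/
theorem not_two_step {k i j : ℕ} (hk : 3 ≤ k) (hi : i < k) (hj : j < k) (h : i = (j + 1) % k)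
    (h' : j = (i + 1) % k) : False := by
  rcases Nat.lt_or_ge (j + 1) k with h1 | h1
  · rw [Nat.mod_eq_of_lt h1] at h
    rcases Nat.lt_or_ge (i + 1) k with h2 | h2
    · rw [Nat.mod_eq_of_lt h2] at h'
      omega
    · rw [show i + 1 = k by omega, Nat.mod_self] at h'
      omega
  · rw [show j + 1 = k by omega, Nat.mod_self] at h
    rw [h, Nat.mod_eq_of_lt (by omega)] at h'
    omega

theorem exists_contains_cycleMatrix {M : BinMatrix} {k : ℕ} (hk : 3 ≤ k)
    (h : CyclePattern (Set.range M.entry) k) :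
    ∃ a, M.ContainsConfiguration (cycleMatrix k a) := by
  obtain ⟨R, z, o, hR, hz⟩ := h
  have : Nonempty (Fin M.rows) := ⟨(hR 0 (by omega)).choose⟩
  choose! ρ hρ using hR
  refine ⟨fun i => R i o, (containsConfiguration_iff _ _).2
    ⟨fun i => ρ (i : Fin k), fun j => if (j : Fin (k + 1)) < k then z (j : Fin (k + 1)) else o,
      ?_, ?_, ?_⟩⟩
  · intro i j hij
    have hij : ρ (i : Fin k) = ρ (j : Fin k) := hij
    have hi : (i : Fin k) < k := (i : Fin k).2
    have hj : (j : Fin k) < k := (j : Fin k).2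
    have hRij : R (i : Fin k) = R (j : Fin k) := by rw [← hρ _ hi, ← hρ _ hj, hij]
    have h1 := (hz _ hi _ hi).2 (Or.inl rfl)
    have h2 := (hz _ hj _ hj).2 (Or.inl rfl)
    rw [hRij, hz _ hj _ hi] at h1
    rw [← hRij, hz _ hi _ hj] at h2
    apply Fin.ext
    rcases h1 with h1 | h1
    · exact h1
    · rcases h2 with h2 | h2
      · exact h2.symm
      · exact (not_two_step hk hi hj h1 h2).elim
  · intro i j hij
    have hij : (if (i : Fin (k + 1)) < k then z (i : Fin (k + 1)) else o) =
      if (j : Fin (k + 1)) < k then z (j : Fin (k + 1)) else o := hij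
    have hi : (i : Fin (k + 1)) < k + 1 := (i : Fin (k + 1)).2
    have hj : (j : Fin (k + 1)) < k + 1 := (j : Fin (k + 1)).2
    apply Fin.ext
    by_cases h1 : ((i : Fin (k + 1)) : ℕ) < k <;> by_cases h2 : ((j : Fin (k + 1)) : ℕ) < k <;>
      simp only [h1, h2, if_true, if_false] at hij
    · have h3 := (hz _ h1 _ h1).2 (Or.inl rfl)
      have h4 := (hz _ h2 _ h2).2 (Or.inl rfl)
      rw [hij, hz _ h1 _ h2] at h3
      rw [← hij, hz _ h2 _ h1] at h4
      rcases h3 with h3 | h3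
      · exact h3.symm
      · rcases h4 with h4 | h4
        · exact h4
        · exact (not_two_step hk h1 h2 h4 h3).elim
    · exact absurd (congrArg _ hij) ((hz _ h1 _ h1).2 (Or.inl rfl))
    · exact absurd (congrArg _ hij.symm) ((hz _ h2 _ h2).2 (Or.inl rfl))
    · omega
  · intro i j
    have hi : (i : Fin k) < k := (i : Fin k).2
    change xor (R (i : Fin k) o) (cycleEntry k (i : Fin k) (j : Fin (k + 1))) =
      M.entry (ρ (i : Fin k)) (if (j : Fin (k + 1)) < k then z (j : Fin (k + 1)) else o)
    rw [hρ _ hi]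
    unfold cycleEntry
    by_cases h1 : ((j : Fin (k + 1)) : ℕ) < k
    · have h2 := hz _ hi _ h1
      simp only [h1, true_and, if_true, ← h2]
      cases R (i : Fin k) o <;> cases R (i : Fin k) (z (j : Fin (k + 1))) <;> simp
    · simp [h1]

/-- Complementing rows of `M_I(3)*` gives no other configurations than `M_I(3)*` and its
complement. -/
theorem containsForbidden_cycleMatrix_three (a : Fin 3 → Bool) :
    (cycleMatrix 3 a).ContainsForbidden := by
  have key : ∀ a : Fin 3 → Bool, ∃ b : Bool, ∃ σ : Fin 4 → Fin 4, (∀ i j, σ i = σ j → i = j) ∧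
      ∀ (i : Fin 3) (j : Fin 4), xor b (cycleEntry 3 i j) = xor (a i) (cycleEntry 3 i (σ j)) := by
    decide +kernel
  obtain ⟨b, σ, hσ, h⟩ := key a
  exact ⟨cycleMatrix 3 fun _ => b, Or.inl (mem_forbRowCol.2 (Or.inl ⟨3, b, le_rfl, rfl⟩)),
    (containsConfiguration_iff _ _).2 ⟨id, σ, Function.injective_id, hσ, h⟩⟩

/-- Four rows that are split by three columns into pairs in the three possible ways. -/
theorem containsForbidden_of_column_splits {M : BinMatrix} (w x y z : Fin M.rows)
    (p q r : Fin M.cols)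
    (p1 : M.entry w p = M.entry x p) (p2 : M.entry y p = M.entry z p)
    (p3 : M.entry w p ≠ M.entry y p)
    (q1 : M.entry w q = M.entry y q) (q2 : M.entry x q = M.entry z q)
    (q3 : M.entry w q ≠ M.entry x q)
    (r1 : M.entry w r = M.entry z r) (r2 : M.entry x r = M.entry y r)
    (r3 : M.entry w r ≠ M.entry x r) : M.ContainsForbidden := by
  have h : CyclePattern (Set.range M.transpose.entry) 3 :=
    cyclePattern_three ⟨p, rfl⟩ ⟨q, rfl⟩ ⟨r, rfl⟩ p1 p2 p3 q1 q2 q3 r1 r2 r3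
  obtain ⟨a, ha⟩ := exists_contains_cycleMatrix le_rfl h
  exact (ContainsForbidden.of_contains ha (containsForbidden_cycleMatrix_three a)).transpose

theorem add_mod_inj {k i j s : ℕ} (hi : i < k) (hj : j < k)
    (h : (i + s) % k = (j + s) % k) : i = j := by
  have : i ≡ j [MOD k] := Nat.ModEq.add_right_cancel' s h
  rwa [Nat.ModEq, Nat.mod_eq_of_lt hi, Nat.mod_eq_of_lt hj] at this

/-- Rotating the binary sequence does not change the configuration. -/
theorem cycleMatrix_contains_rotate {k : ℕ} (hk : 0 < k) (a b : Fin k → Bool) (s : ℕ)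
    (h : ∀ i : Fin k, b i = a ⟨(i + s) % k, Nat.mod_lt _ hk⟩) :
    (cycleMatrix k a).ContainsConfiguration (cycleMatrix k b) := by
  refine (containsConfiguration_iff _ _).2
    ⟨fun i => (⟨((i : Fin k) + s) % k, Nat.mod_lt _ hk⟩ : Fin k),
      fun j => (if h : ((j : Fin (k + 1)) : ℕ) < k then
        ⟨((j : Fin (k + 1)) + s) % k, (Nat.mod_lt _ hk).trans (Nat.lt_succ_self k)⟩
        else Fin.last k : Fin (k + 1)), ?_, ?_, ?_⟩
  · intro i j hij
    exact Fin.ext (add_mod_inj (i : Fin k).2 (j : Fin k).2 (congrArg Fin.val hij))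
  · intro i j hij
    have hi : (i : Fin (k + 1)) < k + 1 := (i : Fin (k + 1)).2
    have hj : (j : Fin (k + 1)) < k + 1 := (j : Fin (k + 1)).2
    have m1 := Nat.mod_lt ((i : Fin (k + 1)) + s) hk
    have m2 := Nat.mod_lt ((j : Fin (k + 1)) + s) hk
    apply Fin.ext
    dsimp only at hij
    split_ifs at hij with h1 h2 h2
    · exact add_mod_inj h1 h2 (congrArg Fin.val hij)
    · have := congrArg Fin.val hij
      simp only [Fin.val_last] at this
      omega
    · have := congrArg Fin.val hij
      simp only [Fin.val_last] at this
      omega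
    · omega
  · intro i j
    have hi : (i : Fin k) < k := (i : Fin k).2
    refine congrArg₂ xor (h i) ?_
    unfold cycleEntry
    by_cases h1 : ((j : Fin (k + 1)) : ℕ) < k
    · have e1 : ((j : Fin (k + 1)) : ℕ) = (i : Fin k) ↔
          ((j : Fin (k + 1)) + s) % k = ((i : Fin k) + s) % k :=
        ⟨fun h => by rw [h], fun h => add_mod_inj h1 hi h⟩
      have e2 : ((j : Fin (k + 1)) : ℕ) = ((i : Fin k) + 1) % k ↔
          ((j : Fin (k + 1)) + s) % k = (((i : Fin k) + s) % k + 1) % k := by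
        have : (((i : Fin k) + s) % k + 1) % k = ((((i : Fin k) : ℕ) + 1) % k + s) % k := by
          rw [Nat.mod_add_mod, Nat.mod_add_mod]
          congr 1
          omega
        rw [this]
        exact ⟨fun h => by rw [h], fun h => add_mod_inj h1 (Nat.mod_lt _ hk) h⟩
      simp only [h1, dif_pos, true_and, e1, e2, Nat.mod_lt _ hk]
    · simp [h1]

/-- Some column in `cols` has a one in row `x` and zeros in the rows `u`, `v` and `w` of
`M_I(k)*`. -/
def singlesOut (k : ℕ) (cols : List ℕ) (x u v w : ℕ) : Bool :=
  cols.any fun j => cycleEntry k x j && !cycleEntry k u j && !cycleEntry k v j &&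
    !cycleEntry k w j

/-- Some column in `cols` has ones in the rows `x` and `u` and zeros in the rows `v` and `w` of
`M_I(k)*`. -/
def joins (k : ℕ) (cols : List ℕ) (x u v w : ℕ) : Bool :=
  cols.any fun j => cycleEntry k x j && cycleEntry k u j && !cycleEntry k v j &&
    !cycleEntry k w j

/-- Row `o` is of one kind, the rows `x`, `y` and `z` are of the other kind, and each of these
three is singled out by a column. -/
def IsTriple {n : ℕ} (k : ℕ) (cols : List ℕ) (a : Fin n → Bool) (o x y z : Fin n) : Bool :=
  (a x == a y) && (a y == a z) && (a o != a x) && singlesOut k cols x o y z &&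
    singlesOut k cols y o x z && singlesOut k cols z o x y

/-- Row `x` is between two rows `l` and `r` of the other kind, and `w` is a further row of the kind
of `x`. -/
def IsIsolated {n : ℕ} (k : ℕ) (cols : List ℕ) (a : Fin n → Bool) (x w l r : Fin n) : Bool :=
  (a w == a x) && (a l != a x) && (a r != a x) && joins k cols x l w r && joins k cols x r w l

/-- The column that has a one only in row `x` puts `x` together with `o`, since the two are of
different kinds; likewise for `y` and `z`. -/
theorem containsForbidden_of_isTriple {k : ℕ} {a : Fin k → Bool} {cols : List ℕ}
    (hcols : ∀ j ∈ cols, j < k) {o x y z : Fin k} (h : IsTriple k cols a o x y z = true) :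
    (cycleMatrix k a).ContainsForbidden := by
  simp only [IsTriple, singlesOut, Bool.and_eq_true, beq_iff_eq, bne_iff_ne, ne_eq,
    List.any_eq_true, Bool.not_eq_true'] at h
  obtain ⟨⟨⟨⟨⟨hxy, hyz⟩, ho⟩, p, hp, ⟨⟨p1, p2⟩, p3⟩, p4⟩, q, hq, ⟨⟨q1, q2⟩, q3⟩, q4⟩,
    r, hr, ⟨⟨r1, r2⟩, r3⟩, r4⟩ := h
  apply containsForbidden_of_column_splits (M := cycleMatrix k a) o x y z
    (⟨p, (hcols p hp).trans (Nat.lt_succ_self k)⟩ : Fin (k + 1))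
    (⟨q, (hcols q hq).trans (Nat.lt_succ_self k)⟩ : Fin (k + 1))
    (⟨r, (hcols r hr).trans (Nat.lt_succ_self k)⟩ : Fin (k + 1)) <;>
  simp only [cycleMatrix, *] <;> grind

/-- The column of zeros separates the two kinds of rows, and the columns shared by `x` and one of
its neighbours put `x` together with the other neighbour. -/
theorem containsForbidden_of_isIsolated {k : ℕ} {a : Fin k → Bool} {cols : List ℕ}
    (hcols : ∀ j ∈ cols, j < k) {x w l r : Fin k} (h : IsIsolated k cols a x w l r = true) :
    (cycleMatrix k a).ContainsForbidden := by
  simp only [IsIsolated, joins, Bool.and_eq_true, beq_iff_eq, bne_iff_ne, ne_eq,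
    List.any_eq_true, Bool.not_eq_true'] at h
  obtain ⟨⟨⟨⟨hw, hl⟩, hr⟩, p, hp, ⟨⟨p1, p2⟩, p3⟩, p4⟩, q, hq, ⟨⟨q1, q2⟩, q3⟩, q4⟩ := h
  have h3 : ∀ i, cycleEntry k i k = false := fun i => by simp [cycleEntry]
  have e := Bool.eq_of_ne_of_ne hl hr
  apply containsForbidden_of_column_splits (M := cycleMatrix k a) x w l r
    (Fin.last k : Fin (k + 1))
    (⟨q, (hcols q hq).trans (Nat.lt_succ_self k)⟩ : Fin (k + 1))
    (⟨p, (hcols p hp).trans (Nat.lt_succ_self k)⟩ : Fin (k + 1)) <;>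
  simp only [cycleMatrix, Fin.val_last, *] <;> grind

/-- For at least seven rows, the rows and columns near a change of the binary sequence suffice. -/
theorem containsForbidden_cycleMatrix_of_seven_le {k : ℕ} (hk : 7 ≤ k) (a : Fin k → Bool)
    (h01 : a ⟨0, by omega⟩ ≠ a ⟨1, by omega⟩) : (cycleMatrix k a).ContainsForbidden := by
  have key : ∀ a : Fin 7 → Bool, a 0 ≠ a 1 →
      ∃ o x y z : Fin 7, IsTriple 8 [1, 2, 3, 4, 5, 6] a o x y z = true := by
    decide +kernel
  -- near the change, the position of the ones does not depend on the number of rows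
  have hentry : ∀ (i : Fin 7), ∀ j ∈ [1, 2, 3, 4, 5, 6], cycleEntry 8 i j = cycleEntry k i j := by
    intro i j hj
    have hi := i.2
    have hj' : 1 ≤ j ∧ j ≤ 6 := by
      simp only [List.mem_cons, List.not_mem_nil, or_false] at hj
      omega
    unfold cycleEntry
    rw [Nat.mod_eq_of_lt (show i.1 + 1 < 8 by omega)]
    rcases Nat.lt_or_ge (i + 1) k with h | h
    · rw [Nat.mod_eq_of_lt h]
      simp [show j < k by omega, show j < 8 by omega]
    · rw [show i.1 + 1 = k by omega, Nat.mod_self]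
      simp [show j < k by omega, show j < 8 by omega, show j ≠ 0 by omega, show j ≠ k by omega]
  have hsingle : ∀ x u v w : Fin 7, singlesOut 8 [1, 2, 3, 4, 5, 6] x u v w =
      singlesOut k [1, 2, 3, 4, 5, 6] x u v w := by
    intro x u v w
    unfold singlesOut
    rw [Bool.eq_iff_iff, List.any_eq_true, List.any_eq_true]
    refine exists_congr fun j => and_congr_right fun hj => ?_
    rw [hentry x j hj, hentry u j hj, hentry v j hj, hentry w j hj]
  obtain ⟨o, x, y, z, h⟩ := key (fun i => a (Fin.castLE hk i)) h01
  refine containsForbidden_of_isTriple (cols := [1, 2, 3, 4, 5, 6]) ?_ (o := Fin.castLE hk o)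
    (x := Fin.castLE hk x) (y := Fin.castLE hk y) (z := Fin.castLE hk z) ?_
  · intro j hj
    simp only [List.mem_cons, List.not_mem_nil, or_false] at hj
    omega
  · rw [← h]
    simp only [IsTriple, hsingle, Fin.val_castLE]

/-- The binary sequences of `ARowCol`, in a list. -/
def aRowColList : List (List Bool) :=
  [[false, false, false, true], [false, false, true, true], [false, true, true, true],
    [false, false, false, false, true], [false, false, false, true, true],
    [false, false, true, true, true], [false, true, true, true, true],
    [false, false, false, true, true, true]]

theorem mem_ARowCol {l : List Bool} : l ∈ ARowCol ↔ l ∈ aRowColList := by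
  simp [ARowCol, aRowColList]

/-- The sequence `a` is, up to rotation by `s`, the sequence `l`. -/
def IsRotation {n : ℕ} [NeZero n] (a : Fin n → Bool) (l : List Bool) (s : Fin n) : Bool :=
  (l.length == n) && (List.finRange n).all fun i => l.getD i false == a (i + s)

/-- The sequence `a` is constant, or a rotation of a sequence of `ARowCol`, or one of the two
sufficient conditions for a forbidden transpose applies. -/
def IsReducible (k : ℕ) [NeZero k] (a : Fin k → Bool) : Prop :=
  (∀ i, a i = a 0) ∨ (∃ l ∈ aRowColList, ∃ s, IsRotation a l s = true) ∨
    (∃ o x y z, IsTriple k (List.range k) a o x y z = true) ∨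
    ∃ x w l r, IsIsolated k (List.range k) a x w l r = true

instance (k : ℕ) [NeZero k] : DecidablePred (IsReducible k) := fun a => by
  unfold IsReducible
  infer_instance

theorem isReducible_four : ∀ a, IsReducible 4 a := by decide +kernel

theorem isReducible_five : ∀ a, IsReducible 5 a := by decide +kernel

theorem isReducible_six : ∀ a, IsReducible 6 a := by decide +kernel

theorem IsReducible.containsForbidden {k : ℕ} [NeZero k] (hk : 3 ≤ k) {a : Fin k → Bool}
    (h : IsReducible k a) :
    (cycleMatrix k a).ContainsForbidden := by
  have hcols : ∀ j ∈ List.range k, j < k := fun j hj => List.mem_range.1 hj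
  rcases h with h | ⟨l, hl, s, hs⟩ | ⟨o, x, y, z, h⟩ | ⟨x, w, l, r, h⟩
  · rw [show a = fun _ => a 0 from funext h]
    exact ContainsForbidden.of_mem (mem_forbRowCol.2 (Or.inl ⟨k, a 0, hk, rfl⟩))
  · simp only [IsRotation, Bool.and_eq_true, beq_iff_eq, List.all_eq_true, List.mem_finRange,
      forall_const] at hs
    obtain ⟨rfl, hs⟩ := hs
    refine ContainsForbidden.of_contains (cycleMatrix_contains_rotate (by omega) a l.get s ?_)
      (ContainsForbidden.of_mem (mem_forbRowCol.2 (Or.inr (Or.inl ⟨l, mem_ARowCol.2 hl, rfl⟩))))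
    intro i
    have := hs i
    rw [List.getD_eq_getElem _ _ i.2] at this
    exact this
  · exact containsForbidden_of_isTriple hcols h
  · exact containsForbidden_of_isIsolated hcols h

theorem containsForbidden_cycleMatrix {k : ℕ} (hk : 3 ≤ k) (a : Fin k → Bool) :
    (cycleMatrix k a).ContainsForbidden := by
  have : NeZero k := ⟨by omega⟩
  rcases hk.eq_or_lt with rfl | hk4
  · exact containsForbidden_cycleMatrix_three a
  by_cases hconst : ∀ i, a i = a 0
  · exact IsReducible.containsForbidden hk (Or.inl hconst)
  rcases Nat.lt_or_ge k 7 with h7 | h7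
  · refine IsReducible.containsForbidden hk ?_
    clear hconst
    interval_cases k
    · exact isReducible_four a
    · exact isReducible_five a
    · exact isReducible_six a
  · -- rotate to a change of the sequence
    obtain ⟨s, hs⟩ : ∃ s : ℕ, a (Fin.ofNat k s) ≠ a (Fin.ofNat k (s + 1)) := by
      by_contra! h
      have key : ∀ s : ℕ, a (Fin.ofNat k s) = a 0 := by
        intro s
        induction s with
        | zero => rfl
        | succ s ih => rw [← h s, ih]
      exact hconst fun i => by
        rw [← key i]
        congr 1
        exact Fin.ext (Nat.mod_eq_of_lt i.2).symm
    refine ContainsForbidden.of_contains (cycleMatrix_contains_rotate (by omega) a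
      (fun i => a (Fin.ofNat k (i + s))) s fun i => rfl)
      (containsForbidden_cycleMatrix_of_seven_le h7 _ ?_)
    simpa [add_comm] using hs

end BinMatrix

/-! ### The transversal pattern and the matrix `M_V*` -/

namespace BinMatrix

/-- For `b = false` the matrix `M_V*`, for `b = true` its complement. -/
def mvMatrix (b : Bool) : BinMatrix := ⟨4, 6, fun i j => xor b (MVast.entry i j)⟩

theorem MVast_eq : MVast = mvMatrix false := by
  unfold mvMatrix
  simp only [Bool.false_xor]
  rfl

theorem compl_MVast_eq : MVast.compl = mvMatrix true := by
  unfold mvMatrix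
  simp only [Bool.true_xor]
  rfl

theorem mvMatrix_mem_forbRowCol (b : Bool) : mvMatrix b ∈ ForbRowCol := by
  rw [mem_forbRowCol, compl_MVast_eq, MVast_eq]
  cases b <;> simp

/-- The transversal pattern: row `i < 3` has the value `x i` exactly in the columns `2 * i` and
`2 * i + 1`, and row `3` has the value `y` exactly in the even columns. -/
def transversalEntry (x : Fin 3 → Bool) (y : Bool) (i : Fin 4) (j : Fin 6) : Bool :=
  if h : (i : ℕ) < 3 then xor (x ⟨i, h⟩) (decide ((j : ℕ) / 2 ≠ i))
  else xor y (decide ((j : ℕ) % 2 ≠ 0))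

/-- Arrangements of the rows and of the columns under which a transversal pattern with exactly one
deviating value becomes `M_V*` or its complement. -/
def mvArrangements : List ((Fin 4 → Fin 4) × (Fin 6 → Fin 6)) :=
  [(![1, 0, 2, 3], ![2, 3, 5, 4, 0, 1]), (![1, 0, 2, 3], ![3, 2, 4, 5, 1, 0]),
   (![0, 1, 2, 3], ![0, 1, 5, 4, 2, 3]), (![0, 1, 2, 3], ![1, 0, 4, 5, 3, 2]),
   (![0, 2, 1, 3], ![0, 1, 3, 2, 4, 5]), (![0, 2, 1, 3], ![1, 0, 2, 3, 5, 4])]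

theorem exists_mvArrangement : ∀ (x : Fin 3 → Bool) (y : Bool), (x 0 = x 1 ∧ x 1 = x 2) ∨
    ∃ b, ∃ e ∈ mvArrangements, ∀ i j,
      xor b (MVast.entry i j) = transversalEntry x y (e.1 i) (e.2 j) := by
  decide +kernel

theorem mvMatrix_separated : ∀ b,
    (∀ i i', (∀ j, (mvMatrix b).entry i j = (mvMatrix b).entry i' j) → i = i') ∧
    (∀ j j', (∀ i, (mvMatrix b).entry i j = (mvMatrix b).entry i j') → j = j') := by
  have key : ∀ b,
    (∀ i i' : Fin 4, (∀ j : Fin 6, xor b (MVast.entry i j) = xor b (MVast.entry i' j)) → i = i') ∧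
    (∀ j j' : Fin 6, (∀ i : Fin 4, xor b (MVast.entry i j) = xor b (MVast.entry i j')) →
      j = j') := by
    decide +kernel
  exact key

/-- If the three distinguished pairs carry the same value, three columns, one of each pair, split
the four rows in the three possible ways; otherwise one pair deviates and the rows form `M_V*`. -/
theorem containsForbidden_of_transversalPattern {M : BinMatrix}
    (h : TransversalPattern (Set.range M.entry)) : M.ContainsForbidden := by
  obtain ⟨_, ⟨q₁, rfl⟩, _, ⟨q₂, rfl⟩, _, ⟨q₃, rfl⟩, _, ⟨t, rfl⟩, a, a', b, b', c, c',
    h1, h2, h3, h4⟩ := h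
  have hne : ∀ u v : Bool, u ≠ v ↔ u = !v := by decide
  simp only [hne] at h1 h2 h3 h4
  obtain ⟨h11, h12, h13, h14, h15⟩ := h1
  obtain ⟨h21, h22, h23, h24, h25⟩ := h2
  obtain ⟨h31, h32, h33, h34, h35⟩ := h3
  obtain ⟨h41, h42, h43, h44, h45⟩ := h4
  have hM : ∀ i j, M.entry (![q₁, q₂, q₃, t] i) (![a, a', b, b', c, c'] j) =
      transversalEntry ![M.entry q₁ a, M.entry q₂ b, M.entry q₃ c] (M.entry t a) i j := by
    intro i j
    fin_cases i <;> fin_cases j <;> simp [transversalEntry, *]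
  rcases exists_mvArrangement ![M.entry q₁ a, M.entry q₂ b, M.entry q₃ c] (M.entry t a) with
    ⟨e1, e2⟩ | ⟨v, e, -, he⟩
  · have e1 : M.entry q₁ a = M.entry q₂ b := e1
    have e2 : M.entry q₂ b = M.entry q₃ c := e2
    by_cases hy : M.entry t a = M.entry q₁ a
    · refine containsForbidden_of_column_splits t q₁ q₂ q₃ a b c ?_ ?_ ?_ ?_ ?_ ?_ ?_ ?_ ?_ <;>
        simp [*]
    · rw [← ne_eq, hne] at hy
      refine containsForbidden_of_column_splits t q₁ q₂ q₃ a' b' c' ?_ ?_ ?_ ?_ ?_ ?_ ?_ ?_ ?_ <;>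
        simp [*]
  · have hN : ∀ i j, (mvMatrix v).entry i j =
        M.entry (![q₁, q₂, q₃, t] (e.1 i)) (![a, a', b, b', c, c'] (e.2 j)) :=
      fun i j => (he i j).trans (hM _ _).symm
    refine ContainsForbidden.of_contains ((containsConfiguration_iff _ _).2 ⟨_, _, ?_, ?_, hN⟩)
      (ContainsForbidden.of_mem (mvMatrix_mem_forbRowCol v))
    · exact fun i i' hi => (mvMatrix_separated v).1 i i' fun j =>
        (hN i j).trans ((congrArg (fun r => M.entry r _) hi).trans (hN i' j).symm)
    · exact fun j j' hj => (mvMatrix_separated v).2 j j' fun i =>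
        (hN i j).trans ((congrArg (M.entry _) hj).trans (hN i j').symm)

/-! ### The characterization -/

theorem circularOnesRows_of_not_containsForbidden {M : BinMatrix} (h : ¬ M.ContainsForbidden) :
    M.CircularOnesRows := by
  refine circularOnesRows_of_not_hasPattern ?_
  rintro (⟨k, hk, hc⟩ | ht)
  · obtain ⟨a, ha⟩ := exists_contains_cycleMatrix hk hc
    exact h (ContainsForbidden.of_contains ha (containsForbidden_cycleMatrix hk a))
  · exact h (containsForbidden_of_transversalPattern ht)

theorem not_circularOnesRows_cycleMatrix {k : ℕ} (hk : 3 ≤ k) (a : Fin k → Bool) :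
    ¬ (cycleMatrix k a).CircularOnesRows := by
  rw [circularOnesRows_iff]
  rintro ⟨f, hf⟩
  have : NeZero k := ⟨by omega⟩
  refine CyclePattern.not_arcs (F := Set.range (cycleMatrix k a).entry) hk
    ⟨fun i => (cycleMatrix k a).entry (Fin.ofNat k i), fun j => Fin.ofNat (k + 1) j, Fin.last k,
      fun i _ => ⟨_, rfl⟩, fun i hi j hj => ?_⟩ ⟨f, fun q ⟨i, hi⟩ => hi ▸ hf i⟩
  change xor (a (Fin.ofNat k i)) (cycleEntry k (i % k) (j % (k + 1))) ≠
    xor (a (Fin.ofNat k i)) (cycleEntry k (i % k) k) ↔ _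
  rw [Nat.mod_eq_of_lt hi, Nat.mod_eq_of_lt (by omega)]
  cases a (Fin.ofNat k i) <;> simp [cycleEntry, hj] <;> tauto

theorem not_circularOnesRows_mvMatrix (b : Bool) : ¬ (mvMatrix b).CircularOnesRows := by
  rw [circularOnesRows_iff]
  rintro ⟨f, hf⟩
  refine TransversalPattern.not_arcs (F := Set.range (mvMatrix b).entry)
    ⟨_, ⟨(0 : Fin 4), rfl⟩, _, ⟨(2 : Fin 4), rfl⟩, _, ⟨(1 : Fin 4), rfl⟩, _, ⟨(3 : Fin 4), rfl⟩,
      (0 : Fin 6), (1 : Fin 6), (3 : Fin 6), (2 : Fin 6), (4 : Fin 6), (5 : Fin 6), ?_⟩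
    ⟨f, fun q ⟨i, hi⟩ => hi ▸ hf i⟩
  cases b <;> decide +kernel

theorem three_le_length {l : List Bool} (hl : l ∈ aRowColList) : 3 ≤ l.length :=
  (by decide : ∀ l ∈ aRowColList, 3 ≤ l.length) l hl

theorem not_circularOnesRows_of_mem {N : BinMatrix} (h : N ∈ ForbRowCol) :
    ¬ N.CircularOnesRows := by
  rcases mem_forbRowCol.1 h with ⟨k, b, hk, rfl⟩ | ⟨l, hl, rfl⟩ | rfl | rfl
  · exact not_circularOnesRows_cycleMatrix hk _
  · exact not_circularOnesRows_cycleMatrix (three_le_length (mem_ARowCol.1 hl)) _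
  · exact MVast_eq ▸ not_circularOnesRows_mvMatrix false
  · exact compl_MVast_eq ▸ not_circularOnesRows_mvMatrix true

theorem not_circularOnesRowsCols_of_mem {N : BinMatrix} (h : N ∈ ForbRowColSymm) :
    ¬ N.CircularOnesRowsCols := by
  rcases h with h | ⟨K, hK, rfl⟩
  · exact fun hN => not_circularOnesRows_of_mem h hN.1
  · exact fun hN => not_circularOnesRows_of_mem hK hN.2

theorem circularOnesRowsCols_iff (M : BinMatrix) :
    M.CircularOnesRowsCols ↔ ∀ N ∈ ForbRowColSymm, ¬ M.ContainsConfiguration N := by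
  constructor
  · exact fun hM N hN hc => not_circularOnesRowsCols_of_mem hN (hM.of_containsConfiguration hc)
  · intro h
    have h : ¬ M.ContainsForbidden := fun ⟨N, hN, hc⟩ => h N hN hc
    exact ⟨circularOnesRows_of_not_containsForbidden h,
      circularOnesRows_of_not_containsForbidden fun h' => h h'.transpose⟩

end BinMatrix

/-! ### Minimality of the forbidden matrices -/

instance {X : Type*} [Fintype X] (f : X → ℕ) (R : X → Bool) : Decidable (ArcRow f R) :=
  inferInstanceAs (Decidable (∃ v, ∀ a b c, R a = v → R c = v → f a ≤ f b → f b ≤ f c → R b = v))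

namespace BinMatrix

theorem IsSubmatrix.eq_of_surjective {N M : BinMatrix} (ρ : Fin N.rows ↪o Fin M.rows)
    (σ : Fin N.cols ↪o Fin M.cols) (h : ∀ i j, N.entry i j = M.entry (ρ i) (σ j))
    (hρ : Function.Surjective ρ) (hσ : Function.Surjective σ) : N = M := by
  obtain ⟨n, m, N⟩ := N
  obtain ⟨n', m', M⟩ := M
  have e1 : n = n' := by simpa using Fintype.card_of_bijective ⟨ρ.injective, hρ⟩
  have e2 : m = m' := by simpa using Fintype.card_of_bijective ⟨σ.injective, hσ⟩
  subst e1 e2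
  have k1 : (ρ : Fin n → Fin n) = id :=
    (ρ.strictMono.range_inj strictMono_id).1 (by rw [hρ.range_eq, Set.range_id])
  have k2 : (σ : Fin m → Fin m) = id :=
    (σ.strictMono.range_inj strictMono_id).1 (by rw [hσ.range_eq, Set.range_id])
  congr 1
  ext i j
  refine (h i j).trans ?_
  change M ((ρ : Fin n → Fin n) i) ((σ : Fin m → Fin m) j) = M i j
  rw [k1, k2]
  rfl

/-- It suffices to delete single rows and single columns; for the columns the whole matrix already
has a circular arrangement. -/
theorem isMinimalForbiddenRowsCols_of_deletions {M : BinMatrix} (hM : ¬ M.CircularOnesRows)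
    (hcols : ∃ g : Fin M.rows → ℕ, ∀ j, ArcRow g fun i => M.entry i j)
    (hrow : ∀ i₀, ∃ f : Fin M.cols → ℕ, ∀ i, i ≠ i₀ → ArcRow f (M.entry i))
    (hcol : ∀ j₀, ∃ f : Fin M.cols → ℕ, ∀ i,
      ArcRow (fun j : {j // j ≠ j₀} => f j) fun j => M.entry i j.1) :
    M.IsMinimalForbiddenRowsCols := by
  refine ⟨fun h => hM h.1, ?_⟩
  rintro N ⟨ρ, σ, h⟩ hne
  have hN : ∀ i, N.entry i = fun j => M.entry (ρ i) (σ j) := fun i => funext (h i)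
  refine ⟨?_, ?_⟩
  · rw [circularOnesRows_iff]
    by_cases hρ : Function.Surjective ρ
    · have hσ : ¬ Function.Surjective σ := fun hσ => hne (IsSubmatrix.eq_of_surjective ρ σ h hρ hσ)
      simp only [Function.Surjective, not_forall, not_exists] at hσ
      obtain ⟨j₀, hj₀⟩ := hσ
      obtain ⟨f, hf⟩ := hcol j₀
      refine ⟨fun j => f (σ j), fun i => ?_⟩
      rw [hN]
      exact (hf (ρ i)).comp fun j => (⟨σ j, hj₀ j⟩ : {j // j ≠ j₀})
    · simp only [Function.Surjective, not_forall, not_exists] at hρ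
      obtain ⟨i₀, hi₀⟩ := hρ
      obtain ⟨f, hf⟩ := hrow i₀
      refine ⟨fun j => f (σ j), fun i => ?_⟩
      rw [hN]
      exact (hf (ρ i) (hi₀ i)).comp σ
  · rw [CircularOnesCols, circularOnesRows_iff]
    obtain ⟨g, hg⟩ := hcols
    refine ⟨fun i => g (ρ i), fun j => ?_⟩
    have := (hg (σ j)).comp ρ
    rwa [show (fun i => M.entry (ρ i) (σ j)) = N.transpose.entry j from
      funext fun i => (h i j).symm] at this

theorem IsMinimalForbiddenRowsCols.transpose {M : BinMatrix} (h : M.IsMinimalForbiddenRowsCols) :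
    M.transpose.IsMinimalForbiddenRowsCols := by
  refine ⟨fun hM => h.1 hM.symm, ?_⟩
  rintro N ⟨ρ, σ, hN⟩ hne
  exact (h.2 N.transpose ⟨σ, ρ, fun i j => hN j i⟩ fun e =>
    hne (congrArg BinMatrix.transpose e)).symm

theorem succ_mod_eq {k i : ℕ} (hi : i < k) :
    (i + 1 < k ∧ (i + 1) % k = i + 1) ∨ (i + 1 = k ∧ (i + 1) % k = 0) := by
  rcases Nat.lt_or_ge (i + 1) k with h | h
  · exact Or.inl ⟨h, Nat.mod_eq_of_lt h⟩
  · have : i + 1 = k := by omega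
    exact Or.inr ⟨this, by rw [this, Nat.mod_self]⟩

theorem cycleEntry_eq_true {k i j : ℕ} :
    cycleEntry k i j = true ↔ j < k ∧ (j = i ∨ j = (i + 1) % k) := by
  simp [cycleEntry]

theorem cycleEntry_eq_false {k i j : ℕ} :
    cycleEntry k i j = false ↔ ¬ (j < k ∧ (j = i ∨ j = (i + 1) % k)) := by
  simp [cycleEntry]

/-- Without row `i₀`, the columns can be arranged starting with column `i₀ + 1`. -/
theorem cycleMatrix_delete_row {k : ℕ} (a : Fin k → Bool) (i₀ : Fin k) :
    ∃ f : Fin (k + 1) → ℕ, ∀ i, i ≠ i₀ → ArcRow f ((cycleMatrix k a).entry i) := by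
  have key : ∀ i : Fin k, i ≠ i₀ →
      ArcRow (fun j : Fin (k + 1) => if j.1 = k then k else if i₀.1 < j.1 then j.1 - (i₀.1 + 1)
        else j.1 + k - (i₀.1 + 1)) fun j => cycleEntry k i j := by
    refine fun i hi => ⟨true, fun x y w hx hw hxy hyw => ?_⟩
    have hne : i.1 ≠ i₀.1 := fun h => hi (Fin.ext h)
    have h1 := i.2
    have h2 := i₀.2
    have h3 := x.2
    have h4 := y.2
    have h5 := w.2
    have h6 := succ_mod_eq h1
    rw [cycleEntry_eq_true] at *
    generalize (i.1 + 1) % k = s at *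
    dsimp only at hxy hyw
    split_ifs at hxy hyw <;> omega
  exact ⟨_, fun i hi => (key i hi).xor (a i)⟩

/-- Without column `j₀`, the column of zeros can take its place (also if it is `j₀` itself). -/
theorem cycleMatrix_delete_col {k : ℕ} (a : Fin k → Bool) (j₀ : Fin (k + 1)) :
    ∃ f : Fin (k + 1) → ℕ, ∀ i, ArcRow (fun j : {j // j ≠ j₀} => f j)
      fun j => (cycleMatrix k a).entry i j.1 := by
  have key : ∀ i : Fin k, ArcRow (fun j : {j // j ≠ j₀} => if j.1.1 = k then j₀.1 else j.1.1)
      fun j => cycleEntry k i j.1 := by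
    intro i
    have h1 := i.2
    have h2 := j₀.2
    -- the ones of the last row surround the zeros
    refine ⟨decide (i.1 + 1 < k), fun x y w hx hw hxy hyw => ?_⟩
    have h3 := x.1.2
    have h4 := y.1.2
    have h5 := w.1.2
    have n1 : x.1.1 ≠ j₀ := fun h => x.2 (Fin.ext h)
    have n2 : y.1.1 ≠ j₀ := fun h => y.2 (Fin.ext h)
    have n3 : w.1.1 ≠ j₀ := fun h => w.2 (Fin.ext h)
    dsimp only at hx hw hxy hyw ⊢
    rcases succ_mod_eq h1 with ⟨h6, h7⟩ | ⟨h6, h7⟩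
    · rw [decide_eq_true h6, cycleEntry_eq_true, h7] at hx hw ⊢
      split_ifs at hxy hyw <;> omega
    · have h8 : ¬ i.1 + 1 < k := by omega
      rw [decide_eq_false h8, cycleEntry_eq_false, h7] at hx hw ⊢
      split_ifs at hxy hyw <;> omega
  exact ⟨fun j => if j.1 = k then j₀.1 else j.1, fun i => (key i).xor (a i)⟩

theorem exists_row_order_cycleMatrix_const (k : ℕ) (b : Bool) : ∃ g : Fin k → ℕ,
    ∀ j, ArcRow g fun i => (cycleMatrix k fun _ => b).entry i j := by
  have key : ∀ j : ℕ, ArcRow (fun i : Fin k => i.1) fun i => cycleEntry k i j := by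
    -- the ones of the first column surround the zeros
    refine fun j => ⟨decide (j ≠ 0), fun x y w hx hw hxy hyw => ?_⟩
    have h1 := succ_mod_eq x.2
    have h2 := succ_mod_eq y.2
    have h3 := succ_mod_eq w.2
    have h4 := x.2
    have h5 := y.2
    have h6 := w.2
    dsimp only at hx hw hxy hyw ⊢
    by_cases h : j ≠ 0
    · rw [decide_eq_true h, cycleEntry_eq_true] at hx hw ⊢
      omega
    · rw [decide_eq_false h, cycleEntry_eq_false] at hx hw ⊢
      omega
  exact ⟨_, fun j => (key (j : Fin (k + 1))).xor b⟩

/-- The matrix `l ⊙ M_I(k)*`, where `k` is the length of `l`. -/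
def listMatrix (l : List Bool) : BinMatrix := cycleMatrix l.length l.get

/-- For the sequences of `ARowCol`, circular arrangements of the rows in which the ones of each
column are consecutive. -/
def rowOrders : List (List Bool × List ℕ) :=
  List.zip aRowColList [[0, 1, 2, 3], [0, 1, 3, 2], [0, 1, 2, 3], [0, 1, 4, 2, 3],
    [0, 1, 2, 4, 3], [0, 1, 4, 3, 2], [0, 2, 1, 4, 3], [0, 1, 2, 5, 4, 3]]

theorem exists_row_order_listMatrix {l : List Bool} (hl : l ∈ aRowColList) : ∃ g : Fin l.length → ℕ,
    ∀ j, ArcRow g fun i => (listMatrix l).entry i j := by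
  have h1 : ∀ l ∈ aRowColList, ∃ e ∈ rowOrders, e.1 = l := by decide +kernel
  have h2 : ∀ e ∈ rowOrders, ∀ j : Fin (e.1.length + 1),
      ArcRow (fun i : Fin e.1.length => e.2.idxOf i.1)
        fun i => xor (e.1.get i) (cycleEntry e.1.length i j) := by
    decide +kernel
  obtain ⟨e, he, rfl⟩ := h1 l hl
  exact ⟨fun i => e.2.idxOf i.1, h2 e he⟩

theorem isMinimalForbiddenRowsCols_cycleMatrix {k : ℕ} (hk : 3 ≤ k) (a : Fin k → Bool)
    (h : ∃ g : Fin k → ℕ, ∀ j, ArcRow g fun i => (cycleMatrix k a).entry i j) :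
    (cycleMatrix k a).IsMinimalForbiddenRowsCols :=
  isMinimalForbiddenRowsCols_of_deletions (not_circularOnesRows_cycleMatrix hk a) h
    (cycleMatrix_delete_row a) (cycleMatrix_delete_col a)

/-- Arrangements of the columns of `M_V*` that become circular arrangements when a suitable row or
column is deleted. -/
def columnOrders : List (List ℕ) :=
  [[0, 1, 2, 3, 4, 5], [0, 1, 2, 5, 4, 3], [0, 1, 4, 5, 2, 3], [0, 1, 5, 2, 3, 4],
    [0, 3, 2, 1, 5, 4]]

theorem isMinimalForbiddenRowsCols_mvMatrix (b : Bool) :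
    (mvMatrix b).IsMinimalForbiddenRowsCols := by
  have hc : ∀ j : Fin 6, ArcRow (fun i : Fin 4 => i.1) fun i => MVast.entry i j := by
    decide +kernel
  have hr : ∀ i₀ : Fin 4, ∃ e ∈ columnOrders, ∀ i : Fin 4, i ≠ i₀ →
      ArcRow (fun j : Fin 6 => e.idxOf j.1) fun j => MVast.entry i j := by
    decide +kernel
  have hd : ∀ j₀ : Fin 6, ∃ e ∈ columnOrders, ∀ i : Fin 4,
      ArcRow (fun j : {j : Fin 6 // j ≠ j₀} => e.idxOf j.1.1) fun j => MVast.entry i j.1 := by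
    decide +kernel
  refine isMinimalForbiddenRowsCols_of_deletions (not_circularOnesRows_mvMatrix b)
    ⟨fun i => (i : Fin 4), fun j => (hc j).xor b⟩ (fun i₀ => ?_) fun j₀ => ?_
  · obtain ⟨e, -, he⟩ := hr i₀
    exact ⟨fun j => e.idxOf (j : Fin 6).1, fun i hi => (he i hi).xor b⟩
  · obtain ⟨e, -, he⟩ := hd j₀
    exact ⟨fun j => e.idxOf (j : Fin 6).1, fun i => (he i).xor b⟩

theorem isMinimalForbiddenRowsCols_of_mem {N : BinMatrix} (h : N ∈ ForbRowColSymm) :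
    N.IsMinimalForbiddenRowsCols := by
  have key : ∀ N ∈ ForbRowCol, N.IsMinimalForbiddenRowsCols := by
    intro N h
    rcases mem_forbRowCol.1 h with ⟨k, b, hk, rfl⟩ | ⟨l, hl, rfl⟩ | rfl | rfl
    · exact isMinimalForbiddenRowsCols_cycleMatrix hk _ (exists_row_order_cycleMatrix_const k b)
    · have hl := mem_ARowCol.1 hl
      exact isMinimalForbiddenRowsCols_cycleMatrix (three_le_length hl) _
        (exists_row_order_listMatrix hl)
    · exact MVast_eq ▸ isMinimalForbiddenRowsCols_mvMatrix false
    · exact compl_MVast_eq ▸ isMinimalForbiddenRowsCols_mvMatrix true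
  rcases h with h | ⟨K, hK, rfl⟩
  · exact key N h
  · exact (key K hK).transpose

/-! ### The forbidden matrices are pairwise different configurations -/

/-- The number of ones of a matrix. -/
def ones (M : BinMatrix) : ℕ := ∑ i, ∑ j, (M.entry i j).toNat

theorem SameConfiguration.rows_eq {M N : BinMatrix} (h : M.SameConfiguration N) :
    M.rows = N.rows := by
  obtain ⟨e, -, -⟩ := h
  simpa using Fintype.card_congr e

theorem SameConfiguration.transpose {M N : BinMatrix} (h : M.SameConfiguration N) :
    M.transpose.SameConfiguration N.transpose := by
  obtain ⟨e, f, h⟩ := h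
  exact ⟨f, e, fun i j => h j i⟩

theorem SameConfiguration.cols_eq {M N : BinMatrix} (h : M.SameConfiguration N) :
    M.cols = N.cols := h.transpose.rows_eq

theorem SameConfiguration.ones_eq {M N : BinMatrix} (h : M.SameConfiguration N) :
    M.ones = N.ones := by
  obtain ⟨e, f, h⟩ := h
  exact Fintype.sum_equiv e _ _ fun i => Fintype.sum_equiv f _ _ fun j => by rw [h]

theorem SameConfiguration.zero_col {M N : BinMatrix} (h : M.SameConfiguration N)
    (hM : ∃ j, ∀ i, M.entry i j = false) : ∃ j, ∀ i, N.entry i j = false := by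
  obtain ⟨e, f, h⟩ := h
  obtain ⟨j, hj⟩ := hM
  exact ⟨f j, fun i => by rw [← e.apply_symm_apply i, ← h, hj]⟩

theorem SameConfiguration.symm {M N : BinMatrix} (h : M.SameConfiguration N) :
    N.SameConfiguration M := by
  obtain ⟨e, f, h⟩ := h
  exact ⟨e.symm, f.symm, fun i j => by rw [h, e.apply_symm_apply, f.apply_symm_apply]⟩

theorem cycleMatrix_const_eq (k : ℕ) (b : Bool) :
    (cycleMatrix k fun _ => b) = listMatrix (List.replicate k b) := by
  have key : ∀ l : List Bool, l.length = k → (∀ x ∈ l, x = b) →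
      (cycleMatrix k fun _ => b) = listMatrix l := by
    rintro l rfl hl
    unfold listMatrix
    congr
    funext i
    exact (hl _ (List.get_mem l i)).symm
  exact key _ List.length_replicate fun x hx => List.eq_of_mem_replicate hx

theorem eq_listMatrix_or_mvMatrix {N : BinMatrix} (h : N ∈ ForbRowCol) :
    (∃ l, N = listMatrix l ∧ (l ∈ aRowColList ∨ ∃ k b, 3 ≤ k ∧ l = List.replicate k b)) ∨
      ∃ b, N = mvMatrix b := by
  rcases mem_forbRowCol.1 h with ⟨k, b, hk, rfl⟩ | ⟨l, hl, rfl⟩ | rfl | rfl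
  · exact Or.inl ⟨_, cycleMatrix_const_eq k b, Or.inr ⟨k, b, hk, rfl⟩⟩
  · exact Or.inl ⟨l, rfl, Or.inl (mem_ARowCol.1 hl)⟩
  · exact Or.inr ⟨false, MVast_eq⟩
  · exact Or.inr ⟨true, compl_MVast_eq⟩

theorem not_sameConfiguration_const {k : ℕ} (hk : 3 ≤ k) :
    ¬ (cycleMatrix k fun _ => false).SameConfiguration (cycleMatrix k fun _ => true) := by
  intro h
  obtain ⟨j, hj⟩ := h.zero_col ⟨Fin.last k, fun i => by simp [cycleMatrix, cycleEntry]⟩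
  have key : ∀ i < k, cycleEntry k i (j : Fin (k + 1)) = true := fun i hi => by
    have : xor true (cycleEntry k i (j : Fin (k + 1))) = false := hj (⟨i, hi⟩ : Fin k)
    simpa using this
  have h0 := key 0 (by omega)
  have h1 := key 1 (by omega)
  have h2 := key 2 (by omega)
  have := succ_mod_eq (show 0 < k by omega)
  have := succ_mod_eq (show 1 < k by omega)
  have := succ_mod_eq (show 2 < k by omega)
  rw [cycleEntry_eq_true] at h0 h1 h2
  omega

/-- Among the sequences of `ARowCol` and the constant ones of the same lengths, the length and the
number of ones in the matrix determine the sequence. -/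
theorem eq_of_ones_eq : ∀ l ∈ aRowColList,
    ∀ l' ∈ aRowColList ++ [List.replicate 4 false, List.replicate 4 true, List.replicate 5 false,
      List.replicate 5 true, List.replicate 6 false, List.replicate 6 true],
    l.length = l'.length → (listMatrix l).ones = (listMatrix l').ones → l = l' := by
  decide +kernel

theorem eq_of_sameConfiguration_listMatrix {l l' : List Bool} (hl : l ∈ aRowColList)
    (hl' : l' ∈ aRowColList ∨ ∃ k b, 3 ≤ k ∧ l' = List.replicate k b)
    (h : (listMatrix l).SameConfiguration (listMatrix l')) : l = l' := by
  refine eq_of_ones_eq l hl l' ?_ h.rows_eq h.ones_eq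
  rcases hl' with hl' | ⟨k, b, -, rfl⟩
  · exact List.mem_append_left _ hl'
  · have h1 : l.length = k := (h.rows_eq : l.length = _).trans List.length_replicate
    have h2 : ∀ l ∈ aRowColList, l.length = 4 ∨ l.length = 5 ∨ l.length = 6 := by decide
    rw [← h1]
    rcases h2 l hl with h2 | h2 | h2 <;> rw [h2] <;> cases b <;> simp

theorem eq_of_sameConfiguration_of_mem_forbRowCol {N N' : BinMatrix} (hN : N ∈ ForbRowCol)
    (hN' : N' ∈ ForbRowCol) (h : N.SameConfiguration N') : N = N' := by
  rcases eq_listMatrix_or_mvMatrix hN with ⟨l, rfl, hl⟩ | ⟨b, rfl⟩ <;>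
    rcases eq_listMatrix_or_mvMatrix hN' with ⟨l', rfl, hl'⟩ | ⟨b', rfl⟩
  · rcases hl with hl | ⟨k, b, hk, rfl⟩
    · rw [eq_of_sameConfiguration_listMatrix hl hl' h]
    · rcases hl' with hl' | ⟨k', b', hk', rfl⟩
      · rw [eq_of_sameConfiguration_listMatrix hl' (Or.inr ⟨k, b, hk, rfl⟩) h.symm]
      · rw [← cycleMatrix_const_eq, ← cycleMatrix_const_eq] at *
        obtain rfl : k = k' := h.rows_eq
        cases b <;> cases b'
        · rfl
        · exact (not_sameConfiguration_const hk h).elim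
        · exact (not_sameConfiguration_const hk h.symm).elim
        · rfl
  · have h1 : l.length = 4 := h.rows_eq
    have h2 : l.length + 1 = 6 := h.cols_eq
    omega
  · have h1 : 4 = l'.length := h.rows_eq
    have h2 : 6 = l'.length + 1 := h.cols_eq
    omega
  · have h1 : (mvMatrix false).ones ≠ (mvMatrix true).ones := by decide +kernel
    cases b <;> cases b'
    · rfl
    · exact absurd h.ones_eq h1
    · exact absurd h.symm.ones_eq h1
    · rfl

theorem rows_lt_cols_of_mem {N : BinMatrix} (h : N ∈ ForbRowCol) : N.rows < N.cols := by
  rcases eq_listMatrix_or_mvMatrix h with ⟨l, rfl, -⟩ | ⟨b, rfl⟩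
  · exact Nat.lt_succ_self l.length
  · exact (by decide : 4 < 6)

theorem eq_of_sameConfiguration {N N' : BinMatrix} (hN : N ∈ ForbRowColSymm)
    (hN' : N' ∈ ForbRowColSymm) (h : N.SameConfiguration N') : N = N' := by
  rcases hN with hN | ⟨K, hK, rfl⟩ <;> rcases hN' with hN' | ⟨K', hK', rfl⟩
  · exact eq_of_sameConfiguration_of_mem_forbRowCol hN hN' h
  · have h1 := rows_lt_cols_of_mem hN
    have h2 := rows_lt_cols_of_mem hK'
    have h3 : N.rows = K'.cols := h.rows_eq
    have h4 : N.cols = K'.rows := h.cols_eq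
    omega
  · have h1 := rows_lt_cols_of_mem hK
    have h2 := rows_lt_cols_of_mem hN'
    have h3 : K.cols = N'.rows := h.rows_eq
    have h4 : K.rows = N'.cols := h.cols_eq
    omega
  · exact congrArg _ (eq_of_sameConfiguration_of_mem_forbRowCol hK hK' h.transpose)

/-- A forbidden matrix `N` outside of `F` contains no matrix of `F`: it would be a proper submatrix,
against the minimality of `N`, or the same configuration as `N`. -/
theorem not_characterizes_of_ssubset {F : Set BinMatrix} (hF : F ⊂ ForbRowColSymm) :
    ¬ CharacterizesCircularOnesRowsCols F := by
  intro hchar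
  obtain ⟨N, hN, hNF⟩ := Set.exists_of_ssubset hF
  have hmin := isMinimalForbiddenRowsCols_of_mem hN
  have hex := mt (hchar N).2 hmin.1
  push Not at hex
  obtain ⟨N', hN'F, S, hS, hSN'⟩ := hex
  have hN' := hF.1 hN'F
  by_cases hSN : S = N
  · rw [hSN] at hSN'
    exact hNF (eq_of_sameConfiguration hN hN' hSN' ▸ hN'F)
  · exact not_circularOnesRowsCols_of_mem hN' ((hmin.2 S hS hSN).of_containsConfiguration
      ⟨S, ⟨RelEmbedding.refl _, RelEmbedding.refl _, fun _ _ => rfl⟩, hSN'⟩)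

end BinMatrix

theorem mainTheorem5 :
    (∀ M : BinMatrix,
      M.CircularOnesRowsCols ↔ ∀ N ∈ BinMatrix.ForbRowColSymm, ¬ M.ContainsConfiguration N) ∧
    (∀ F : Set BinMatrix, F ⊂ BinMatrix.ForbRowColSymm →
      ¬ BinMatrix.CharacterizesCircularOnesRowsCols F) ∧
    (∀ N ∈ BinMatrix.ForbRowColSymm, N.IsMinimalForbiddenRowsCols) :=
  ⟨BinMatrix.circularOnesRowsCols_iff, fun _ => BinMatrix.not_characterizes_of_ssubset,
    fun _ => BinMatrix.isMinimalForbiddenRowsCols_of_mem⟩
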